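/- Let $\mathbb D$ be the open unit disc in $\mathbb C$ and $\rho(\zeta,\eta)=\operatorname{artanh}\left|\frac{\zeta-\eta}{1-\bar\eta\zeta}\right|$ its hyperbolic distance. For a set $V\subset\mathbb C^n$, a function on $V$ is called holomorphic if near each point of $V$ it is the restriction to $V$ of a holomorphic function on an open subset of $\mathbb C^n$. For $z,w\in V$ put $$c_V(z,w)=\sup\{\rho(F(z),F(w)) : F:V\to\mathbb D\text{ holomorphic}\}$$ (the Carathéodory pseudodistance) and $$l_V(z,w)=\inf\{\rho(0,t): t\in\mathbb D,\ \text{there is a holomorphic } f:\mathbb D\to\mathbb C^n \text{ with } f(\mathbb D)\subset V,\ f(0)=z,\ f(t)=w\}$$ (the Lempert function, with $\inf\emptyset=\infty$). An analytic subset $V$ of a domain $D\subset\mathbb C^n$ is called a Carathéodory set in $D$ if $c_D(z,w)=c_V(z,w)$ for all $z,w\in V$. It is called a retract of $D$ if there is a holomorphic map $r:D\to D$ with range $V$ and $r|_V=\mathrm{id}$. **Theorem.** For every $\alpha=(\alpha_1,\alpha_2,\alpha_3)\in\mathbb C^3\setminus\{0\}$ the set $$M_\alpha=\{z\in\mathbb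 D^3:\ \alpha_1z_1+\alpha_2z_2+\alpha_3z_3=\bar\alpha_3z_1z_2+\bar\alpha_2z_1z_3+\bar\alpha_1z_2z_3\}$$ is a Carathéodory set in $\mathbb D^3$. Moreover, for all $z,w\in M_\alpha$, $$l_{M_\alpha}(z,w)=c_{M_\alpha}(z,w)=c_{\mathbb D^3}(z,w).$$ If $\alpha$ satisfies the triangle inequality, i.e. $|\alpha_{i_1}|+|\alpha_{i_2}|>|\alpha_{i_3}|$ for every permutation $(i_1,i_2,i_3)$ of $\{1,2,3\}$, then $M_\alpha$ is not a retract of $\mathbb D^3$. -/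

import Mathlib

open Set Metric
open scoped ComplexConjugate ENNReal

/-- The Poincaré (hyperbolic) distance `ρ` of the open unit disc,
`ρ(z, w) = artanh |(z - w) / (1 - w̄ z)|`; it is used only for points of the disc. -/
noncomputable def poincareDist (z w : ℂ) : ℝ :=
  Real.artanh ‖(z - w) / (1 - conj w * z)‖

/-- `f` is holomorphic on an arbitrary subset `V` of the ambient space: locally, it is the restriction
to `V` of a function that is holomorphic on an open set. Only the values of `f` on `V` matter. -/
def HolomorphicOnSet {E : Type*} [NormedAddCommGroup E] [NormedSpace ℂ E]
    (V : Set E) (f : E → ℂ) : Prop :=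
  ∀ w ∈ V, ∃ W : Set E, IsOpen W ∧ w ∈ W ∧
    ∃ g : E → ℂ, DifferentiableOn ℂ g W ∧ EqOn f g (V ∩ W)

/-- The family `𝒪(V, 𝔻)` of holomorphic functions on `V` with values in the open unit disc. -/
def holomorphicToDisc {E : Type*} [NormedAddCommGroup E] [NormedSpace ℂ E]
    (V : Set E) : Set (E → ℂ) :=
  {F | HolomorphicOnSet V F ∧ MapsTo F V (ball (0 : ℂ) 1)}

/-- The Carathéodory pseudodistance `c_V(z, w) = sup {ρ(F(z), F(w)) : F ∈ 𝒪(V, 𝔻)}`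
(for `z, w ∈ V`), as an extended nonnegative number. -/
noncomputable def caratheodoryDist {E : Type*} [NormedAddCommGroup E] [NormedSpace ℂ E]
    (V : Set E) (z w : E) : ℝ≥0∞ :=
  ⨆ F ∈ holomorphicToDisc V, ENNReal.ofReal (poincareDist (F z) (F w))

/-- The Lempert function `l_M(w, z) = inf {ρ(0, t)}`, over all `t ∈ 𝔻` for which some holomorphic
map `f` from the disc to the ambient space has its image in `M`, `f(0) = w` and `f(t) = z`.
It is `∞` if there is no such map. -/
noncomputable def lempertFunction {E : Type*} [NormedAddCommGroup E] [NormedSpace ℂ E]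
    (M : Set E) (w z : E) : ℝ≥0∞ :=
  ⨅ t ∈ {t : ℂ | t ∈ ball (0 : ℂ) 1 ∧ ∃ f : ℂ → E, DifferentiableOn ℂ f (ball (0 : ℂ) 1) ∧
      MapsTo f (ball (0 : ℂ) 1) M ∧ f 0 = w ∧ f t = z},
    ENNReal.ofReal (poincareDist 0 t)

/-- `V` is an analytic subset of the open set `D`: relatively closed in `D` and, near each of its
points, the common zero set of finitely many holomorphic functions. -/
structure IsAnalyticSubset {E : Type*} [NormedAddCommGroup E] [NormedSpace ℂ E]
    (D V : Set E) : Prop where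
  subset : V ⊆ D
  closed : ∃ C : Set E, IsClosed C ∧ V = D ∩ C
  locally_zeros : ∀ x ∈ V, ∃ U : Set E, IsOpen U ∧ U ⊆ D ∧ x ∈ U ∧
    ∃ (m : ℕ) (f : Fin m → E → ℂ), (∀ j, DifferentiableOn ℂ (f j) U) ∧
      V ∩ U = {z ∈ U | ∀ j, f j z = 0}

/-- `V` is a Carathéodory set in the domain `D`: an analytic subset of `D` on which the
Carathéodory pseudodistances of `D` and of `V` agree. -/
structure IsCaratheodorySet {E : Type*} [NormedAddCommGroup E] [NormedSpace ℂ E]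
    (D V : Set E) : Prop where
  analytic : IsAnalyticSubset D V
  dist_eq : ∀ z ∈ V, ∀ w ∈ V, caratheodoryDist D z w = caratheodoryDist V z w

/-- `V` is a (holomorphic) retract of the domain `D`: the range of a holomorphic map `r : D → D`
that is the identity on `V`. -/
def IsHolomorphicRetract {E : Type*} [NormedAddCommGroup E] [NormedSpace ℂ E]
    (D V : Set E) : Prop :=
  ∃ r : E → E, DifferentiableOn ℂ r D ∧ MapsTo r D D ∧ r '' D = V ∧ ∀ z ∈ V, r z = z

/-- The tridisc `𝔻³`. -/
def tridisc : Set (Fin 3 → ℂ) :=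
  {z | ∀ j, ‖z j‖ < 1}

/-- The set `M_α`; the coordinates `1, 2, 3` are numbered `0, 1, 2`. -/
def surfaceM (α : Fin 3 → ℂ) : Set (Fin 3 → ℂ) :=
  {z | z ∈ tridisc ∧ α 0 * z 0 + α 1 * z 1 + α 2 * z 2 =
    conj (α 2) * z 0 * z 1 + conj (α 1) * z 0 * z 2 + conj (α 0) * z 1 * z 2}

/-- The triple `α` satisfies the (strict) triangle inequality: for every permutation
`(i₁, i₂, i₃)` of the indices, `|α_{i₁}| + |α_{i₂}| > |α_{i₃}|`. -/
def SatisfiesTriangleInequality (α : Fin 3 → ℂ) : Prop :=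
  ∀ σ : Equiv.Perm (Fin 3), ‖α (σ 0)‖ + ‖α (σ 1)‖ > ‖α (σ 2)‖

/-!
# The surfaces `M_α` in the tridisc

For `z, w ∈ V ⊆ 𝔻³` one always has `c_{𝔻³} ≤ c_V ≤ l_V`, by restriction of functions and by the
Schwarz–Pick lemma, and `c_{𝔻³}(z, w) ≥ ρ(z_j, w_j)` for each coordinate. So all the distances
agree as soon as any two points `z, w` of `M_α` lie on a holomorphic disc in `M_α` parametrized by
one of the coordinates (`HasCoordinateDiscs`), and this property is invariant under coordinatewise
biholomorphic maps (`HasCoordinateDiscs.transport`).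

Rotations make the coefficients of `M_α` nonnegative (`exists_rotation`), and Cayley transforms
then turn `M_α` into the surface `β₀ x₁ x₂ + β₁ x₀ x₂ + β₂ x₀ x₁ = -s` in the product of three upper
half-planes, where `β_j = ∑ |α_k| - 2 |α_j|` and `s = ∑ |α_k|`.

* If some `β_k ≤ 0`, the surface is a graph over the other two coordinates, and the two-point
  Nevanlinna–Pick theorem gives the disc (`exists_disc_halfPlaneSurface`).
* If all `β_k > 0`, which is the triangle inequality, real Möbius transformations of the coordinates
  turn the surface into `ξ₀ ξ₁ ξ₂ = -1`. A disc `(z, g z, -1 / (z g z))` lies in it exactly when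
  both `g` and `z ↦ z g(z)` are Nevanlinna functions, that is, when `g` is a Stieltjes function.
  So the disc comes from a two-point interpolation theorem for Stieltjes functions
  (`exists_isStieltjes`): the Pick conditions for `g` and for `z g(z)` together suffice. They
  hold when the parameter is the coordinate in which the two points are farthest apart.

The interpolation theorem is proved for extremal data, where the solution is a Möbius
transformation (`exists_isStieltjes_of_eq`), and extended by convexity of the Stieltjes class
(`exists_of_extremal`).

If `r` is a retraction onto `M_α`, then by the Schwarz lemma `r'(0)` is a projection of norm at most
one of `ℂ³`, with the sup norm, onto `ker α`. Computing the norms of its rows shows that no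
such projection exists under the triangle inequality.
-/

/-! ### Möbius interpolation of extremal data in the half-plane -/

/-- The open upper half-plane, as a set of complex numbers. -/
def halfPlane : Set ℂ := {z | 0 < z.im}

/-- The solvability condition `ρ(p, q) ≤ ρ(l, m)` of the two-point Nevanlinna–Pick problem
`l ↦ p`, `m ↦ q` in the upper half-plane, with denominators cleared: the hyperbolic distance is an
increasing function of `|p - q|² / (Im p · Im q)`. -/
def PickLe (l m p q : ℂ) : Prop :=
  Complex.normSq (p - q) * (l.im * m.im) ≤ Complex.normSq (l - m) * (p.im * q.im)

theorem ne_ofReal_of_mem_halfPlane {z : ℂ} (hz : z ∈ halfPlane) (t : ℝ) : (t : ℂ) - z ≠ 0 := by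
  intro h
  have := congrArg Complex.im h
  simp at this
  exact hz.ne' this

theorem ne_zero_of_mem_halfPlane {z : ℂ} (hz : z ∈ halfPlane) : z ≠ 0 := by
  simpa using ne_ofReal_of_mem_halfPlane hz 0

theorem sub_conj_ne_zero {z w : ℂ} (hz : z ∈ halfPlane) (hw : w ∈ halfPlane) :
    z - conj w ≠ 0 := by
  intro h
  have := congrArg Complex.im h
  simp at this
  have h1 : 0 < z.im := hz
  have h2 : 0 < w.im := hw
  linarith

theorem normSq_sub_conj (z w : ℂ) :
    Complex.normSq (z - conj w) = Complex.normSq (z - w) + 4 * (z.im * w.im) := by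
  simp [Complex.normSq_apply]; ring

/-- For fixed `p`, a point `q` of the half-plane is determined by the quotient
`(p - q) / (p - q̄)`. -/
theorem eq_of_pseudohyperbolic_eq {p q r κ : ℂ} (hκ : ‖κ‖ < 1) (hq : p - q = κ * (p - conj q))
    (hr : p - r = κ * (p - conj r)) : q = r := by
  have h : q - r = κ * conj (q - r) := by
    rw [map_sub]; linear_combination hr - hq
  have h2 : ‖q - r‖ = ‖κ‖ * ‖q - r‖ := by
    conv_lhs => rw [h]
    rw [norm_mul, Complex.norm_conj]
  have : ‖q - r‖ = 0 := by
    by_contra hne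
    have hpos : 0 < ‖q - r‖ := lt_of_le_of_ne (norm_nonneg _) (Ne.symm hne)
    nlinarith
  exact sub_eq_zero.mp (norm_eq_zero.mp this)

/-- Extremal two-point data in the half-plane are interpolated by a real Möbius transformation,
which has either a finite real pole `t` or its pole at infinity. -/
theorem exists_moebius_of_eq {l m p q : ℂ} (hl : l ∈ halfPlane) (hm : m ∈ halfPlane)
    (hp : p ∈ halfPlane) (hq : q ∈ halfPlane) (hlm : l ≠ m)
    (h : Complex.normSq (p - q) * (l.im * m.im) = Complex.normSq (l - m) * (p.im * q.im)) :
    (∃ γ n t : ℝ, 0 < n ∧ p = γ + n / (t - l) ∧ q = γ + n / (t - m)) ∨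
      ∃ γ k : ℝ, 0 < k ∧ p = γ + k * l ∧ q = γ + k * m := by
  have hl' : 0 < l.im := hl
  have hm' : 0 < m.im := hm
  have hp' : 0 < p.im := hp
  have hq' : 0 < q.im := hq
  have hlm0 : l - m ≠ 0 := sub_ne_zero.mpr hlm
  have hlmc := sub_conj_ne_zero hl hm
  have hpqc := sub_conj_ne_zero hp hq
  set κ := (p - q) / (p - conj q) with hκd
  have hκq : p - q = κ * (p - conj q) := by rw [hκd]; field_simp
  have hκ : ‖κ‖ < 1 := by
    rw [← sq_lt_one_iff₀ (norm_nonneg _), ← Complex.normSq_eq_norm_sq, hκd, Complex.normSq_div,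
      div_lt_one (Complex.normSq_pos.mpr hpqc), normSq_sub_conj]
    have := mul_pos hp' hq'
    linarith
  -- For `g z = γ + n / (t - z)` with `g l = p`, `g m = q`, this is `(t - m̄) / (t - m)`: it has
  -- modulus one, it determines the pole `t`, and it equals one when the pole is at infinity.
  set ω := κ * (l - conj m) / (l - m) with hωd
  have hω : Complex.normSq ω = 1 := by
    have h1 : Complex.normSq (l - m) ≠ 0 := (Complex.normSq_pos.mpr hlm0).ne'
    have h2 : Complex.normSq (p - conj q) ≠ 0 := (Complex.normSq_pos.mpr hpqc).ne'
    rw [hωd, hκd, Complex.normSq_div, Complex.normSq_mul, Complex.normSq_div, div_mul_eq_mul_div,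
      div_div, div_eq_one_iff_eq (mul_ne_zero h2 h1), normSq_sub_conj, normSq_sub_conj]
    linear_combination 4 * h
  have hωκ : κ * (l - conj m) = ω * (l - m) := by rw [hωd]; field_simp
  have hωω : ω * conj ω = 1 := by rw [Complex.mul_conj, hω]; simp
  have real_of : ∀ z : ℂ, z.im = 0 → z = (z.re : ℂ) := fun z hz => by
    apply Complex.ext <;> simp [hz]
  by_cases hω1 : ω = 1
  · right
    set k : ℝ := p.im / l.im with hk
    have hkl : k * l.im = p.im := by rw [hk]; field_simp
    have hγ := real_of (p - k * l) (by simp [hkl])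
    refine ⟨(p - k * l).re, k, by positivity, by rw [← hγ]; ring, ?_⟩
    refine eq_of_pseudohyperbolic_eq hκ hκq ?_
    rw [← hγ]
    have hc : conj (p - k * l) = p - k * l := by
      rw [hγ, Complex.conj_ofReal]
    rw [map_add, hc, map_mul, Complex.conj_ofReal]
    rw [hω1] at hωκ
    linear_combination (-(k : ℂ)) * hωκ
  · left
    have hω1' : ω - 1 ≠ 0 := sub_ne_zero.mpr hω1
    have hωc : conj ω - 1 ≠ 0 := by
      intro hh
      apply hω1'
      have := congrArg conj hh
      simpa using this
    have htr : conj ((ω * m - conj m) / (ω - 1)) = (ω * m - conj m) / (ω - 1) := by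
      rw [map_div₀, map_sub, map_sub, map_mul, Complex.conj_conj, map_one,
        div_eq_div_iff hωc hω1']
      linear_combination (conj m - m) * hωω
    obtain ⟨t, ht⟩ := Complex.conj_eq_iff_real.mp htr
    have htm : (t : ℂ) - conj m = ω * (t - m) := by
      have : (t : ℂ) * (ω - 1) = ω * m - conj m := by rw [← ht]; field_simp
      linear_combination -this
    have htl := ne_ofReal_of_mem_halfPlane hl t
    have htm0 := ne_ofReal_of_mem_halfPlane hm t
    have hω0 : ω ≠ 0 := by
      intro h0; rw [h0] at hωω; simp at hωω
    have hnl : 0 < Complex.normSq (t - l) := Complex.normSq_pos.mpr htl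
    set n : ℝ := p.im * Complex.normSq (t - l) / l.im with hn
    have hγ := real_of (p - n / (t - l)) (by
      rw [Complex.sub_im, Complex.div_im]
      simp only [Complex.ofReal_re, Complex.ofReal_im, Complex.sub_im, zero_mul, zero_div, zero_sub]
      rw [hn]; field_simp; ring)
    refine ⟨(p - n / (t - l)).re, n, t, by positivity, by rw [← hγ]; ring, ?_⟩
    refine eq_of_pseudohyperbolic_eq hκ hκq ?_
    rw [← hγ]
    have hc : conj (p - n / (t - l)) = p - n / (t - l) := by
      rw [hγ, Complex.conj_ofReal]
    rw [map_add, hc, map_div₀, map_sub, Complex.conj_ofReal, Complex.conj_ofReal, htm]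
    have htl' : (t : ℂ) - l ≠ 0 := htl
    field_simp
    linear_combination -(n : ℂ) * hωκ + κ * n * htm

/-! ### Two-point interpolation by Nevanlinna and Stieltjes functions -/

/-- A Nevanlinna function: a holomorphic self-map of the upper half-plane. -/
def IsNevanlinna (g : ℂ → ℂ) : Prop :=
  DifferentiableOn ℂ g halfPlane ∧ MapsTo g halfPlane halfPlane

/-- A (nonconstant) Stieltjes function: a Nevanlinna function `g` for which `z ↦ z * g z` is a
Nevanlinna function as well. -/
def IsStieltjes (g : ℂ → ℂ) : Prop :=
  IsNevanlinna g ∧ MapsTo (fun z => z * g z) halfPlane halfPlane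

theorem convex_halfPlane : Convex ℝ halfPlane := convex_halfSpace_im_gt 0

theorem IsNevanlinna.combo {g h : ℂ → ℂ} (hg : IsNevanlinna g) (hh : IsNevanlinna h) {a b : ℝ}
    (ha : 0 ≤ a) (hb : 0 ≤ b) (hab : a + b = 1) : IsNevanlinna fun z => a • g z + b • h z :=
  ⟨(hg.1.const_smul a).add (hh.1.const_smul b),
    fun _ hz => convex_halfPlane (hg.2 hz) (hh.2 hz) ha hb hab⟩

theorem IsStieltjes.combo {g h : ℂ → ℂ} (hg : IsStieltjes g) (hh : IsStieltjes h) {a b : ℝ}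
    (ha : 0 ≤ a) (hb : 0 ≤ b) (hab : a + b = 1) : IsStieltjes fun z => a • g z + b • h z := by
  refine ⟨hg.1.combo hh.1 ha hb hab, fun z hz => ?_⟩
  have := convex_halfPlane (hg.2 hz) (hh.2 hz) ha hb hab
  simpa only [mul_add, mul_smul_comm] using this

theorem neg_inv_mem_halfPlane {z : ℂ} (hz : z ∈ halfPlane) : -z⁻¹ ∈ halfPlane := by
  have h1 : 0 < z.im := hz
  have h2 := Complex.normSq_pos.mpr (ne_zero_of_mem_halfPlane hz)
  change 0 < (-z⁻¹).im
  rw [Complex.neg_im, Complex.inv_im, ← neg_div, neg_neg]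
  positivity

theorem IsStieltjes.neg_inv {g : ℂ → ℂ} (hg : IsStieltjes g) :
    IsStieltjes fun z => -(z * g z)⁻¹ := by
  refine ⟨⟨((differentiableOn_id.mul hg.1.1).inv
    fun z hz => ne_zero_of_mem_halfPlane (hg.2 hz)).neg,
    fun z hz => neg_inv_mem_halfPlane (hg.2 hz)⟩, fun z hz => ?_⟩
  have h0 := ne_zero_of_mem_halfPlane hz
  have := neg_inv_mem_halfPlane (hg.1.2 hz)
  have h1 := ne_zero_of_mem_halfPlane (hg.1.2 hz)
  convert this using 1
  field_simp

theorem im_add_div_sub (γ n t : ℝ) (z : ℂ) :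
    ((γ : ℂ) + n / (t - z)).im = n * z.im / Complex.normSq (t - z) := by
  rw [Complex.add_im, Complex.div_im]
  simp only [Complex.ofReal_re, Complex.ofReal_im, Complex.sub_im]
  ring

theorem im_mul_add_div_sub (γ n t : ℝ) {z : ℂ} (hz : z ∈ halfPlane) :
    (z * (γ + n / (t - z))).im = z.im * (γ + n * t / Complex.normSq (t - z)) := by
  have h := ne_ofReal_of_mem_halfPlane hz t
  have h1 : z * (γ + n / (t - z)) = γ * z - n + n * t / (t - z) := by field_simp; ring
  rw [h1, Complex.add_im, Complex.sub_im, Complex.div_im, Complex.im_ofReal_mul]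
  simp only [Complex.ofReal_im, Complex.sub_im, Complex.mul_re, Complex.mul_im, Complex.ofReal_re]
  ring

theorem isNevanlinna_add_div_sub (γ t : ℝ) {n : ℝ} (hn : 0 < n) :
    IsNevanlinna fun z => (γ : ℂ) + n / (t - z) := by
  refine ⟨(differentiableOn_const _).add ((differentiableOn_const _).div
    ((differentiableOn_const _).sub differentiableOn_id)
    fun z hz => ne_ofReal_of_mem_halfPlane hz t), fun z hz => ?_⟩
  have h1 : 0 < z.im := hz
  have h2 := Complex.normSq_pos.mpr (ne_ofReal_of_mem_halfPlane hz t)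
  change 0 < Complex.im _
  rw [im_add_div_sub]
  positivity

theorem isNevanlinna_affine (γ : ℝ) {k : ℝ} (hk : 0 < k) :
    IsNevanlinna fun z => (γ : ℂ) + k * z := by
  refine ⟨by fun_prop, fun z hz => ?_⟩
  have h1 : 0 < z.im := hz
  change 0 < Complex.im _
  simp only [Complex.add_im, Complex.ofReal_im, Complex.im_ofReal_mul, zero_add]
  positivity

theorem exists_isNevanlinna_of_eq {l m p q : ℂ} (hl : l ∈ halfPlane) (hm : m ∈ halfPlane)
    (hp : p ∈ halfPlane) (hq : q ∈ halfPlane) (hlm : l ≠ m)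
    (h : Complex.normSq (p - q) * (l.im * m.im) = Complex.normSq (l - m) * (p.im * q.im)) :
    ∃ g, IsNevanlinna g ∧ g l = p ∧ g m = q := by
  rcases exists_moebius_of_eq hl hm hp hq hlm h with ⟨γ, n, t, hn, h1, h2⟩ | ⟨γ, k, hk, h1, h2⟩
  · exact ⟨_, isNevanlinna_add_div_sub γ t hn, h1.symm, h2.symm⟩
  · exact ⟨_, isNevanlinna_affine γ hk, h1.symm, h2.symm⟩

/-- If the Nevanlinna–Pick data are extremal, then the unique solution is a Möbius transformation,
and the Pick condition for `z ↦ z * g z` alone makes it a Stieltjes function. -/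
theorem exists_isStieltjes_of_eq {l m p q : ℂ} (hl : l ∈ halfPlane) (hm : m ∈ halfPlane)
    (hp : p ∈ halfPlane) (hq : q ∈ halfPlane) (hlp : l * p ∈ halfPlane) (hlm : l ≠ m)
    (h : Complex.normSq (p - q) * (l.im * m.im) = Complex.normSq (l - m) * (p.im * q.im))
    (h' : PickLe l m (l * p) (m * q)) :
    ∃ g, IsStieltjes g ∧ g l = p ∧ g m = q := by
  have hl' : 0 < l.im := hl
  have hm' : 0 < m.im := hm
  have hlm' : 0 < Complex.normSq (l - m) := Complex.normSq_pos.mpr (sub_ne_zero.mpr hlm)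
  have hlp' : 0 < (l * p).im := hlp
  rw [PickLe] at h'
  rcases exists_moebius_of_eq hl hm hp hq hlm h with ⟨γ, n, t, hn, h1, h2⟩ | ⟨γ, k, hk, h1, h2⟩
  · refine ⟨_, ⟨isNevanlinna_add_div_sub γ t hn, fun z hz => ?_⟩, h1.symm, h2.symm⟩
    have htl := ne_ofReal_of_mem_halfPlane hl t
    have htm := ne_ofReal_of_mem_halfPlane hm t
    have e1 := im_mul_add_div_sub γ n t hl
    have e2 := im_mul_add_div_sub γ n t hm
    rw [← h1] at e1
    rw [← h2] at e2
    have e3 : l * p - m * q = (l - m) * (γ + (n * t : ℝ) * ((t - l)⁻¹ * (t - m)⁻¹)) := by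
      rw [h1, h2]; push_cast; field_simp; ring
    set u := ((t : ℂ) - l)⁻¹ with hu
    set v := ((t : ℂ) - m)⁻¹ with hv
    have e4 : ∀ z : ℂ, n * t / Complex.normSq z = n * t * Complex.normSq z⁻¹ := fun z => by
      rw [Complex.normSq_inv]; rfl
    rw [e4, ← hu] at e1
    rw [e4, ← hv] at e2
    have hui : 0 < u.im := by
      rw [hu, Complex.inv_im]
      simpa using div_pos hl' (Complex.normSq_pos.mpr htl)
    have hvi : 0 < v.im := by
      rw [hv, Complex.inv_im]
      simpa using div_pos hm' (Complex.normSq_pos.mpr htm)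
    rw [e3, Complex.normSq_mul, e1, e2] at h'
    rw [e1] at hlp'
    have hA : 0 < γ + n * t * Complex.normSq u := pos_of_mul_pos_right hlp' hl'.le
    have h3 : Complex.normSq (γ + (n * t : ℝ) * (u * v)) ≤
        (γ + n * t * Complex.normSq u) * (γ + n * t * Complex.normSq v) := by
      have : 0 < Complex.normSq (l - m) * (l.im * m.im) := by positivity
      refine le_of_mul_le_mul_left ?_ this
      linarith
    -- The two sides of `h3` differ by `γ n t |u - v̄|²`, so `γ` and `n t` cannot have opposite
    -- signs.
    have h4 : 0 ≤ γ * (n * t) * ((u.re - v.re) ^ 2 + (u.im + v.im) ^ 2) := by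
      simp only [Complex.normSq_apply, Complex.add_re, Complex.add_im, Complex.mul_re,
        Complex.mul_im, Complex.ofReal_re, Complex.ofReal_im] at h3
      linarith
    have h5 : 0 ≤ γ * (n * t) := nonneg_of_mul_nonneg_left h4 (by positivity)
    have hu2 : 0 < Complex.normSq u := Complex.normSq_pos.mpr (by
      intro h0; rw [h0] at hui; simp at hui)
    have hz2 := Complex.normSq_pos.mpr (ne_ofReal_of_mem_halfPlane hz t)
    have hz' : 0 < z.im := hz
    change 0 < Complex.im _
    rw [im_mul_add_div_sub γ n t hz]
    refine mul_pos hz' ?_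
    rcases lt_trichotomy γ 0 with hγ | hγ | hγ
    · nlinarith [nonpos_of_mul_nonneg_right h5 hγ]
    · rw [hγ, zero_add] at hA ⊢
      exact div_pos (pos_of_mul_pos_left hA hu2.le) hz2
    · have : 0 ≤ n * t := nonneg_of_mul_nonneg_right h5 hγ
      positivity
  · exfalso
    have e3 : l * p - m * q = (l - m) * (γ + k * (l + m)) := by rw [h1, h2]; ring
    have e1 : (l * p).im = l.im * (γ + 2 * k * l.re) := by rw [h1]; simp; ring
    have e2 : (m * q).im = m.im * (γ + 2 * k * m.re) := by rw [h2]; simp; ring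
    rw [e3, Complex.normSq_mul, e1, e2] at h'
    have h3 : Complex.normSq (γ + k * (l + m)) ≤
        (γ + 2 * k * l.re) * (γ + 2 * k * m.re) := by
      have : 0 < Complex.normSq (l - m) * (l.im * m.im) := by positivity
      refine le_of_mul_le_mul_left ?_ this
      linarith
    simp only [Complex.normSq_apply, Complex.add_re, Complex.add_im, Complex.mul_re,
        Complex.mul_im, Complex.ofReal_re, Complex.ofReal_im] at h3
    have : 0 < k ^ 2 * ((l.re - m.re) ^ 2 + (l.im + m.im) ^ 2) := by positivity
    linarith

/-- Along a real translation the Pick defect of `q` is a quadratic polynomial tending to `∞`, so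
a translation in either direction makes one of two prescribed constraints an equality. -/
theorem exists_shift {l m p q : ℂ} (hl : l ∈ halfPlane) (hm : m ∈ halfPlane)
    (hp : p ∈ halfPlane) (hq : q ∈ halfPlane) (h : PickLe l m p q) {φ : ℝ → ℝ}
    (hφ : Continuous φ) (h0 : φ 0 ≤ 0) {ε : ℝ} (hε : ε = 1 ∨ ε = -1) :
    ∃ s : ℝ, 0 ≤ s ∧ PickLe l m p (q + (ε * s : ℝ)) ∧ φ (ε * s) ≤ 0 ∧
      (Complex.normSq (p - (q + (ε * s : ℝ))) * (l.im * m.im) =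
        Complex.normSq (l - m) * (p.im * (q + (ε * s : ℝ)).im) ∨ φ (ε * s) = 0) := by
  have hl' : 0 < l.im := hl
  have hm' : 0 < m.im := hm
  have hp' : 0 < p.im := hp
  have hq' : 0 < q.im := hq
  set ψ : ℝ → ℝ := fun s => Complex.normSq (p - (q + (ε * s : ℝ))) * (l.im * m.im) -
    Complex.normSq (l - m) * (p.im * (q + (ε * s : ℝ)).im) with hψ
  have hψc : Continuous ψ := by
    rw [hψ]
    have : Continuous Complex.normSq := Complex.continuous_normSq
    have h2 : Continuous Complex.im := Complex.continuous_im
    fun_prop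
  -- The Pick condition says that `|p - q - ε s|² ≤ K`, and it fails for `s = |x| + K + 1`.
  set K := Complex.normSq (l - m) * (p.im * q.im) / (l.im * m.im) with hK
  have hK0 : 0 ≤ K := by have := Complex.normSq_nonneg (l - m); positivity
  set x := (p - q).re with hx
  have hS0 : (0 : ℝ) ≤ |x| + K + 1 := by positivity
  have hS : 0 ≤ ψ (|x| + K + 1) := by
    have e1 : (q + (ε * (|x| + K + 1) : ℝ)).im = q.im := by simp
    have e2 : K ≤ Complex.normSq (p - (q + (ε * (|x| + K + 1) : ℝ))) := by
      rw [Complex.normSq_apply]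
      have : (p - (q + (ε * (|x| + K + 1) : ℝ))).re = x - ε * (|x| + K + 1) := by
        rw [hx, Complex.sub_re, Complex.sub_re, Complex.add_re, Complex.ofReal_re]; ring
      rw [this]
      have h3 := abs_le.mp (le_refl |x|)
      have h5 : (K + 1) ^ 2 ≤ (x - ε * (|x| + K + 1)) ^ 2 := by
        rcases hε with rfl | rfl <;> nlinarith
      nlinarith [mul_self_nonneg (p - (q + (ε * (|x| + K + 1) : ℝ))).im]
    have e3 : Complex.normSq (l - m) * (p.im * q.im) = K * (l.im * m.im) := by
      rw [hK]; field_simp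
    change 0 ≤ _ - _
    rw [e1, e3, ← sub_mul]
    exact mul_nonneg (sub_nonneg.mpr e2) (by positivity)
  have hc : Continuous fun s => max (ψ s) (φ (ε * s)) := hψc.max (by fun_prop)
  have hb : max (ψ 0) (φ (ε * 0)) ≤ 0 := by
    refine max_le ?_ (by simpa using h0)
    simpa [hψ, PickLe] using h
  obtain ⟨s, hs, hs0⟩ := intermediate_value_Icc hS0 hc.continuousOn
    ⟨hb, hS.trans (le_max_left _ _)⟩
  simp only at hs0
  refine ⟨s, hs.1, sub_nonpos.mp ((le_max_left _ _).trans hs0.le),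
    (le_max_right _ _).trans hs0.le, ?_⟩
  rcases max_choice (ψ s) (φ (ε * s)) with h1 | h1
  · left; rw [h1] at hs0; exact sub_eq_zero.mp hs0
  · right; rw [← h1]; exact hs0

/-- A convex family of functions that solves all two-point problems `l ↦ p`, `m ↦ q` with extremal
data solves all of them: translate `q` in both real directions until the data are extremal, and
take a convex combination of the two solutions. -/
theorem exists_of_extremal {P : (ℂ → ℂ) → Prop}
    (hP : ∀ g h, P g → P h → ∀ a b : ℝ, 0 ≤ a → 0 ≤ b → a + b = 1 →
      P fun z => a • g z + b • h z) {l m p q : ℂ} (hl : l ∈ halfPlane) (hm : m ∈ halfPlane)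
    (hp : p ∈ halfPlane) (hq : q ∈ halfPlane) (h : PickLe l m p q) {φ : ℝ → ℝ}
    (hφ : Continuous φ) (h0 : φ 0 ≤ 0)
    (hsol : ∀ s : ℝ, PickLe l m p (q + s) → φ s ≤ 0 →
      (Complex.normSq (p - (q + s)) * (l.im * m.im) =
        Complex.normSq (l - m) * (p.im * (q + s).im) ∨ φ s = 0) →
      ∃ g, P g ∧ g l = p ∧ g m = q + s) :
    ∃ g, P g ∧ g l = p ∧ g m = q := by
  obtain ⟨s, hs, h1, h2, h3⟩ := exists_shift hl hm hp hq h hφ h0 (.inl rfl)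
  obtain ⟨r, hr, k1, k2, k3⟩ := exists_shift hl hm hp hq h hφ h0 (.inr rfl)
  obtain ⟨g, hg, hgl, hgm⟩ := hsol _ h1 h2 h3
  obtain ⟨f, hf, hfl, hfm⟩ := hsol _ k1 k2 k3
  have hmem : (0 : ℝ) ∈ segment ℝ (-1 * r) (1 * s) := by
    rw [segment_eq_Icc (by linarith)]
    constructor <;> linarith
  obtain ⟨a, b, ha, hb, hab, hz⟩ := hmem
  have habc : (a : ℂ) + b = 1 := by exact_mod_cast hab
  have hzc : (a : ℂ) * (-1 * r : ℝ) + b * (1 * s : ℝ) = 0 := by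
    have : ((a • (-1 * r) + b • (1 * s) : ℝ) : ℂ) = 0 := by rw [hz]; rfl
    simpa using this
  refine ⟨_, hP f g hf hg a b ha hb hab, ?_, ?_⟩
  · simp only [hfl, hgl, Complex.real_smul]
    linear_combination p * habc
  · simp only [hfm, hgm, Complex.real_smul]
    linear_combination q * habc + hzc

theorem add_ofReal_mem_halfPlane {q : ℂ} (hq : q ∈ halfPlane) (s : ℝ) :
    q + s ∈ halfPlane := by
  have : 0 < q.im := hq
  simpa [halfPlane] using this

/-- The two-point Nevanlinna–Pick theorem in the upper half-plane. -/
theorem exists_isNevanlinna {l m p q : ℂ} (hl : l ∈ halfPlane) (hm : m ∈ halfPlane)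
    (hp : p ∈ halfPlane) (hq : q ∈ halfPlane) (hlm : l ≠ m) (h : PickLe l m p q) :
    ∃ g, IsNevanlinna g ∧ g l = p ∧ g m = q := by
  refine exists_of_extremal (φ := fun _ => -1)
    (fun g f hg hf a b ha hb hab => hg.combo hf ha hb hab) hl hm hp hq h continuous_const
    (by norm_num) fun s _ _ hs => ?_
  exact exists_isNevanlinna_of_eq hl hm hp (add_ofReal_mem_halfPlane hq s) hlm
    (hs.resolve_right (by norm_num))

theorem normSq_neg_inv_sub {z w : ℂ} (hz : z ≠ 0) (hw : w ≠ 0) :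
    Complex.normSq (-z⁻¹ - -w⁻¹) =
      Complex.normSq (z - w) / (Complex.normSq z * Complex.normSq w) := by
  have : -z⁻¹ - -w⁻¹ = (z - w) / (z * w) := by field_simp; ring
  rw [this, Complex.normSq_div, Complex.normSq_mul]

theorem im_neg_inv (z : ℂ) : (-z⁻¹).im = z.im / Complex.normSq z := by
  rw [Complex.neg_im, Complex.inv_im]; ring

/-- The two-point interpolation theorem for Stieltjes functions: the Pick conditions
for `g` and for `z ↦ z * g z` are jointly sufficient. -/
theorem exists_isStieltjes {l m p q : ℂ} (hl : l ∈ halfPlane) (hm : m ∈ halfPlane)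
    (hp : p ∈ halfPlane) (hq : q ∈ halfPlane) (hlp : l * p ∈ halfPlane)
    (hlm : l ≠ m) (h : PickLe l m p q) (h' : PickLe l m (l * p) (m * q)) :
    ∃ g, IsStieltjes g ∧ g l = p ∧ g m = q := by
  have hl' : 0 < l.im := hl
  have hm' : 0 < m.im := hm
  have hlp' : 0 < (l * p).im := hlp
  have hlm' : 0 < Complex.normSq (l - m) := Complex.normSq_pos.mpr (sub_ne_zero.mpr hlm)
  refine exists_of_extremal (φ := fun s => Complex.normSq (l * p - m * (q + s)) * (l.im * m.im) -
    Complex.normSq (l - m) * ((l * p).im * (m * (q + s)).im))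
    (fun g f hg hf a b ha hb hab => hg.combo hf ha hb hab) hl hm hp hq h ?_ ?_
    fun s h1 h2 h3 => ?_
  · have : Continuous Complex.normSq := Complex.continuous_normSq
    have h2 : Continuous Complex.im := Complex.continuous_im
    fun_prop
  · simpa [PickLe] using h'
  · have hq' := add_ofReal_mem_halfPlane hq s
    set r : ℂ := q + s
    have hPick : PickLe l m (l * p) (m * r) := sub_nonpos.mp h2
    rcases h3 with h3 | h3
    · exact exists_isStieltjes_of_eq hl hm hp hq' hlp hlm h3 hPick
    · have h3 := sub_eq_zero.mp h3
      have hmr : m * r ∈ halfPlane := by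
        by_contra hneg
        have hneg' : (m * r).im ≤ 0 := not_lt.mp hneg
        have h4 : Complex.normSq (l - m) * ((l * p).im * (m * r).im) ≤ 0 :=
          mul_nonpos_of_nonneg_of_nonpos hlm'.le
            (mul_nonpos_of_nonneg_of_nonpos hlp'.le hneg')
        have h5 : Complex.normSq (l * p - m * r) = 0 := by
          have h6 : 0 < l.im * m.im := by positivity
          nlinarith [Complex.normSq_nonneg (l * p - m * r)]
        rw [Complex.normSq_eq_zero, sub_eq_zero] at h5
        rw [← h5] at hneg'
        linarith
      -- The involution `g ↦ -1 / (z * g z)` exchanges the two Pick conditions.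
      have hl0 := ne_zero_of_mem_halfPlane hl
      have hm0 := ne_zero_of_mem_halfPlane hm
      have hp0 := ne_zero_of_mem_halfPlane hp
      have hr0 := ne_zero_of_mem_halfPlane hq'
      have hlp0 := ne_zero_of_mem_halfPlane hlp
      have hmr0 := ne_zero_of_mem_halfPlane hmr
      have el : l * -(l * p)⁻¹ = -p⁻¹ := by field_simp
      have em : m * -(m * r)⁻¹ = -r⁻¹ := by field_simp
      obtain ⟨g, hg, hgl, hgm⟩ := exists_isStieltjes_of_eq hl hm (neg_inv_mem_halfPlane hlp)
        (neg_inv_mem_halfPlane hmr) (by rw [el]; exact neg_inv_mem_halfPlane hp) hlm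
        (by
          rw [normSq_neg_inv_sub hlp0 hmr0, im_neg_inv, im_neg_inv, div_mul_eq_mul_div, h3]
          ring)
        (by
          rw [PickLe, el, em, normSq_neg_inv_sub hp0 hr0, im_neg_inv, im_neg_inv,
            div_mul_eq_mul_div, div_mul_div_comm, ← mul_div_assoc]
          have := Complex.normSq_nonneg p
          have := Complex.normSq_nonneg r
          exact div_le_div_of_nonneg_right h1 (by positivity))
      refine ⟨_, hg.neg_inv, ?_, ?_⟩
      · simp only [hgl, el]; simp
      · simp only [hgm, em]; simp

/-! ### Coordinate discs in surfaces over the half-plane -/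

/-- Any two points `p`, `q` of `N` lie on a holomorphic disc `h : Ω → N` whose parameter is one
of the coordinates: `h (p j) = p` and `h (q j) = q` for some `j`. -/
def HasCoordinateDiscs (Ω : Set ℂ) (N : Set (Fin 3 → ℂ)) : Prop :=
  ∀ p ∈ N, ∀ q ∈ N, ∃ j : Fin 3, ∃ h : ℂ → Fin 3 → ℂ,
    DifferentiableOn ℂ h Ω ∧ MapsTo h Ω N ∧ h (p j) = p ∧ h (q j) = q

/-- Coordinate discs are transported by coordinatewise biholomorphic maps. -/
theorem HasCoordinateDiscs.transport {Ω Ω' : Set ℂ} {N N' : Set (Fin 3 → ℂ)}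
    (hN : HasCoordinateDiscs Ω N) (φ ψ : Fin 3 → ℂ → ℂ)
    (hφ : ∀ j, DifferentiableOn ℂ (φ j) Ω') (hψ : ∀ j, DifferentiableOn ℂ (ψ j) Ω)
    (hφΩ : ∀ j, MapsTo (φ j) Ω' Ω) (hψφ : ∀ j, ∀ z ∈ Ω', ψ j (φ j z) = z)
    (hNΩ : ∀ x ∈ N, ∀ j, x j ∈ Ω) (hNΩ' : ∀ x ∈ N', ∀ j, x j ∈ Ω')
    (hφN : ∀ x ∈ N', (fun j => φ j (x j)) ∈ N) (hψN : ∀ x ∈ N, (fun j => ψ j (x j)) ∈ N') :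
    HasCoordinateDiscs Ω' N' := by
  intro p hp q hq
  obtain ⟨j, h, hd, hm, hhp, hhq⟩ := hN _ (hφN p hp) _ (hφN q hq)
  refine ⟨j, fun z k => ψ k (h (φ j z) k), ?_, fun z hz => hψN _ (hm (hφΩ j hz)), ?_, ?_⟩
  · rw [differentiableOn_pi]
    intro k
    have h1 : DifferentiableOn ℂ (fun z => h z k) Ω := differentiableOn_pi.mp hd k
    exact (hψ k).comp (h1.comp (hφ j) (hφΩ j)) fun z hz => hNΩ _ (hm (hφΩ j hz)) k
  · funext k
    simp only [hhp]
    exact hψφ k _ (hNΩ' p hp k)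
  · funext k
    simp only [hhq]
    exact hψφ k _ (hNΩ' q hq k)

/-- An increasing function of the hyperbolic distance of two points of the half-plane. -/
noncomputable def hypRatio (z w : ℂ) : ℝ := Complex.normSq (z - w) / (z.im * w.im)

theorem pickLe_of_hypRatio_le {l m p q : ℂ} (hl : l ∈ halfPlane) (hm : m ∈ halfPlane)
    (hp : p ∈ halfPlane) (hq : q ∈ halfPlane) (h : hypRatio p q ≤ hypRatio l m) :
    PickLe l m p q := by
  have h1 : 0 < l.im * m.im := mul_pos hl hm
  have h2 : 0 < p.im * q.im := mul_pos hp hq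
  exact (div_le_div_iff₀ h2 h1).mp h

theorem eq_of_hypRatio_le {l p q : ℂ} (hp : p ∈ halfPlane) (hq : q ∈ halfPlane)
    (h : hypRatio p q ≤ hypRatio l l) : p = q := by
  have h2 : 0 < p.im * q.im := mul_pos hp hq
  have h3 : hypRatio p q ≤ 0 := by simpa [hypRatio] using h
  have h4 : Complex.normSq (p - q) ≤ 0 := by
    by_contra hc
    exact absurd h3 (not_le.mpr (div_pos (not_le.mp hc) h2))
  exact sub_eq_zero.mp (Complex.normSq_eq_zero.mp (le_antisymm h4 (Complex.normSq_nonneg _)))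

/-- The surface `ξ₀ ξ₁ ξ₂ = -1` in the product of three half-planes. -/
def productSurface : Set (Fin 3 → ℂ) :=
  {x | (∀ j, x j ∈ halfPlane) ∧ ∏ j, x j = -1}

theorem productSurface_comp_perm {x : Fin 3 → ℂ} (hx : x ∈ productSurface)
    (σ : Equiv.Perm (Fin 3)) : x ∘ σ ∈ productSurface :=
  ⟨fun j => hx.1 (σ j), by rw [← hx.2]; exact Equiv.prod_comp σ x⟩

/-- The discs in the surface `ξ₀ ξ₁ ξ₂ = -1` with parameter `ξ₀` are given by Stieltjes functions
`ξ₁ = g(ξ₀)`, since then `ξ₂ = -1 / (ξ₀ g(ξ₀))`. -/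
theorem exists_disc_productSurface {p q : Fin 3 → ℂ} (hp : p ∈ productSurface)
    (hq : q ∈ productSurface) (hpq : p 0 ≠ q 0)
    (hmax : ∀ k, hypRatio (p k) (q k) ≤ hypRatio (p 0) (q 0)) :
    ∃ h : ℂ → Fin 3 → ℂ, DifferentiableOn ℂ h halfPlane ∧ MapsTo h halfPlane productSurface ∧
      h (p 0) = p ∧ h (q 0) = q := by
  have key : ∀ x ∈ productSurface, x 2 = -(x 0 * x 1)⁻¹ := by
    intro x hx
    have h2 := hx.2
    rw [Fin.prod_univ_three] at h2
    have h0 := ne_zero_of_mem_halfPlane (hx.1 0)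
    have h1 := ne_zero_of_mem_halfPlane (hx.1 1)
    field_simp
    linear_combination h2
  have key' : ∀ x ∈ productSurface, x 0 * x 1 = -(x 2)⁻¹ := by
    intro x hx
    rw [key x hx, inv_neg, inv_inv, neg_neg]
  have hprod : ∀ x ∈ productSurface, x 0 * x 1 ∈ halfPlane := by
    intro x hx
    rw [key' x hx]
    exact neg_inv_mem_halfPlane (hx.1 2)
  have hinv : hypRatio (p 0 * p 1) (q 0 * q 1) = hypRatio (p 2) (q 2) := by
    have hp2 := ne_zero_of_mem_halfPlane (hp.1 2)
    have hq2 := ne_zero_of_mem_halfPlane (hq.1 2)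
    rw [key' p hp, key' q hq, hypRatio, hypRatio, normSq_neg_inv_sub hp2 hq2, im_neg_inv,
      im_neg_inv, div_mul_div_comm,
      div_div_div_cancel_right₀ (mul_ne_zero (Complex.normSq_pos.mpr hp2).ne'
        (Complex.normSq_pos.mpr hq2).ne')]
  obtain ⟨g, hg, hgp, hgq⟩ := exists_isStieltjes (hp.1 0) (hq.1 0) (hp.1 1) (hq.1 1) (hprod p hp)
    hpq (pickLe_of_hypRatio_le (hp.1 0) (hq.1 0) (hp.1 1) (hq.1 1) (hmax 1))
    (pickLe_of_hypRatio_le (hp.1 0) (hq.1 0) (hprod p hp) (hprod q hq) (hinv ▸ hmax 2))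
  refine ⟨fun z => ![z, g z, -(z * g z)⁻¹], ?_, fun z hz => ⟨?_, ?_⟩, ?_, ?_⟩
  · rw [differentiableOn_pi]
    intro k
    fin_cases k
    · exact differentiableOn_id
    · exact hg.1.1
    · exact hg.neg_inv.1.1
  · intro k
    fin_cases k
    · exact hz
    · exact hg.1.2 hz
    · exact hg.neg_inv.1.2 hz
  · have h0 := ne_zero_of_mem_halfPlane hz
    have h1 := ne_zero_of_mem_halfPlane (hg.1.2 hz)
    simp only [Fin.prod_univ_three, Matrix.cons_val]
    field_simp
  · funext k
    fin_cases k
    · rfl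
    · exact hgp
    · simp [hgp, key p hp]
  · funext k
    fin_cases k
    · rfl
    · exact hgq
    · simp [hgq, key q hq]

theorem exists_const_disc {Ω : Set ℂ} {N : Set (Fin 3 → ℂ)} {p : Fin 3 → ℂ} (hp : p ∈ N) :
    ∃ j : Fin 3, ∃ h : ℂ → Fin 3 → ℂ,
      DifferentiableOn ℂ h Ω ∧ MapsTo h Ω N ∧ h (p j) = p ∧ h (p j) = p :=
  ⟨0, fun _ => p, differentiableOn_const _, fun _ _ => hp, rfl, rfl⟩

theorem comp_perm_disc {Ω : Set ℂ} {h : ℂ → Fin 3 → ℂ} (hd : DifferentiableOn ℂ h Ω)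
    (σ : Equiv.Perm (Fin 3)) : DifferentiableOn ℂ (fun z => h z ∘ σ) Ω :=
  differentiableOn_pi.mpr fun k => differentiableOn_pi.mp hd (σ k)

theorem hasCoordinateDiscs_productSurface : HasCoordinateDiscs halfPlane productSurface := by
  intro p hp q hq
  rcases eq_or_ne p q with rfl | hpq
  · exact exists_const_disc hp
  obtain ⟨j, hj⟩ := Finite.exists_max fun k => hypRatio (p k) (q k)
  have hpj : p j ≠ q j := by
    intro h
    apply hpq
    funext k
    have := hj k
    rw [h] at this
    exact eq_of_hypRatio_le (hp.1 k) (hq.1 k) this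
  set σ : Equiv.Perm (Fin 3) := Equiv.swap 0 j with hσ
  have hσ0 : σ 0 = j := Equiv.swap_apply_left 0 j
  have hσσ : ∀ x : Fin 3 → ℂ, (x ∘ σ) ∘ σ = x := fun x => by
    funext k
    simp [hσ]
  obtain ⟨h, hd, hm, hhp, hhq⟩ := exists_disc_productSurface (productSurface_comp_perm hp σ)
    (productSurface_comp_perm hq σ) (by simpa [hσ0] using hpj)
    (fun k => by simpa [hσ0] using hj (σ k))
  simp only [Function.comp_apply, hσ0] at hhp hhq
  refine ⟨j, fun z => h z ∘ σ, comp_perm_disc hd σ,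
    fun z hz => productSurface_comp_perm (hm hz) σ, ?_, ?_⟩
  · simp only [hhp, hσσ]
  · simp only [hhq, hσσ]

/-- The image of the surface `M_α` under coordinatewise Cayley transforms; with denominators
cleared its equation is `β₀ x₁ x₂ + β₁ x₀ x₂ + β₂ x₀ x₁ = -s`. -/
def halfPlaneSurface (β : Fin 3 → ℝ) (s : ℝ) : Set (Fin 3 → ℂ) :=
  {x | (∀ j, x j ∈ halfPlane) ∧ (∑ j, β j * (x j)⁻¹) * ∏ j, x j = -s}

theorem mem_halfPlaneSurface {β : Fin 3 → ℝ} {s : ℝ} {x : Fin 3 → ℂ} :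
    x ∈ halfPlaneSurface β s ↔ (∀ j, x j ∈ halfPlane) ∧
      β 0 * x 1 * x 2 + β 1 * x 0 * x 2 + β 2 * x 0 * x 1 = -s := by
  refine and_congr_right fun hx => ?_
  have h0 := ne_zero_of_mem_halfPlane (hx 0)
  have h1 := ne_zero_of_mem_halfPlane (hx 1)
  have h2 := ne_zero_of_mem_halfPlane (hx 2)
  rw [Fin.sum_univ_three, Fin.prod_univ_three]
  have : (β 0 * (x 0)⁻¹ + β 1 * (x 1)⁻¹ + β 2 * (x 2)⁻¹) * (x 0 * x 1 * x 2) =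
      β 0 * x 1 * x 2 + β 1 * x 0 * x 2 + β 2 * x 0 * x 1 := by
    field_simp
  rw [this]

theorem halfPlaneSurface_comp_perm {β : Fin 3 → ℝ} {s : ℝ} {x : Fin 3 → ℂ}
    (hx : x ∈ halfPlaneSurface β s) (σ : Equiv.Perm (Fin 3)) :
    x ∘ σ ∈ halfPlaneSurface (β ∘ σ) s := by
  refine ⟨fun j => hx.1 (σ j), ?_⟩
  rw [← hx.2]
  congr 1
  · exact Equiv.sum_comp σ fun j => (β j : ℂ) * (x j)⁻¹
  · exact Equiv.prod_comp σ x

theorem combo_mem_halfPlane {a b : ℝ} (ha : 0 ≤ a) (hb : 0 ≤ b) (hab : 0 < a + b) {z w : ℂ}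
    (hz : z ∈ halfPlane) (hw : w ∈ halfPlane) : a * z + b * w ∈ halfPlane := by
  have h1 : 0 < z.im := hz
  have h2 : 0 < w.im := hw
  change 0 < Complex.im _
  rw [Complex.add_im, Complex.im_ofReal_mul, Complex.im_ofReal_mul]
  rcases ha.eq_or_lt with rfl | ha'
  · have : 0 < b := by linarith
    positivity
  · positivity

/-- If `β₂ ≤ 0`, then the surface is the graph of a holomorphic function of `(x₀, x₁)` with values
in the half-plane, so that any disc in the first two coordinates lifts to it. -/
theorem exists_disc_halfPlaneSurface {β : Fin 3 → ℝ} {s : ℝ} (hs : 0 < s) (h0 : 0 ≤ β 0)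
    (h1 : 0 ≤ β 1) (h01 : 0 < β 0 + β 1) (h2 : β 2 ≤ 0) {p q : Fin 3 → ℂ}
    (hp : p ∈ halfPlaneSurface β s) (hq : q ∈ halfPlaneSurface β s) (hpq : p ≠ q)
    (hmax : hypRatio (p 1) (q 1) ≤ hypRatio (p 0) (q 0)) :
    ∃ h : ℂ → Fin 3 → ℂ, DifferentiableOn ℂ h halfPlane ∧
      MapsTo h halfPlane (halfPlaneSurface β s) ∧ h (p 0) = p ∧ h (q 0) = q := by
  have h10 : 0 < β 1 + β 0 := by linarith
  -- The solution `x₂` of the equation, written so that its imaginary part is visibly positive.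
  set K : ℂ → ℂ → ℂ := fun a b => (s : ℂ) * -(β 0 * b + β 1 * a)⁻¹ +
    (-β 2 : ℝ) * -(β 0 * -a⁻¹ + β 1 * -b⁻¹)⁻¹ with hK
  have hden : ∀ {a b : ℂ}, a ∈ halfPlane → b ∈ halfPlane → (β 0 * b + β 1 * a : ℂ) ≠ 0 :=
    fun ha hb => ne_zero_of_mem_halfPlane (combo_mem_halfPlane h0 h1 h01 hb ha)
  have hden' : ∀ {a b : ℂ}, a ∈ halfPlane → b ∈ halfPlane →
      (β 0 * -a⁻¹ + β 1 * -b⁻¹ : ℂ) ≠ 0 :=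
    fun ha hb => ne_zero_of_mem_halfPlane (combo_mem_halfPlane h0 h1 h01
      (neg_inv_mem_halfPlane ha) (neg_inv_mem_halfPlane hb))
  have hKmem : ∀ {a b : ℂ}, a ∈ halfPlane → b ∈ halfPlane → K a b ∈ halfPlane := fun ha hb =>
    combo_mem_halfPlane hs.le (by linarith) (by linarith)
      (neg_inv_mem_halfPlane (combo_mem_halfPlane h0 h1 h01 hb ha))
      (neg_inv_mem_halfPlane (combo_mem_halfPlane h0 h1 h01
        (neg_inv_mem_halfPlane ha) (neg_inv_mem_halfPlane hb)))
  have hKeq : ∀ {a b : ℂ}, a ∈ halfPlane → b ∈ halfPlane →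
      K a b * (β 0 * b + β 1 * a) = -s - β 2 * a * b := by
    intro a b ha hb
    have ha0 := ne_zero_of_mem_halfPlane ha
    have hb0 := ne_zero_of_mem_halfPlane hb
    have hd := hden ha hb
    have e : (β 0 * -a⁻¹ + β 1 * -b⁻¹ : ℂ) = -((β 0 * b + β 1 * a) / (a * b)) := by
      field_simp; ring
    simp only [hK]
    rw [e, inv_neg, neg_neg, inv_div]
    push_cast
    field_simp
    ring
  have huniq : ∀ x ∈ halfPlaneSurface β s, K (x 0) (x 1) = x 2 := by
    intro x hx
    obtain ⟨hx1, hx2⟩ := mem_halfPlaneSurface.mp hx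
    refine mul_right_cancel₀ (hden (hx1 0) (hx1 1)) ?_
    rw [hKeq (hx1 0) (hx1 1)]
    linear_combination -hx2
  have hp01 : p 0 ≠ q 0 := by
    intro h
    rw [h] at hmax
    have h' := eq_of_hypRatio_le (hp.1 1) (hq.1 1) hmax
    apply hpq
    funext k
    fin_cases k
    · exact h
    · exact h'
    · change p 2 = q 2
      rw [← huniq p hp, ← huniq q hq, h, h']
  obtain ⟨g, hg, hgp, hgq⟩ := exists_isNevanlinna (hp.1 0) (hq.1 0) (hp.1 1) (hq.1 1) hp01
    (pickLe_of_hypRatio_le (hp.1 0) (hq.1 0) (hp.1 1) (hq.1 1) hmax)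
  refine ⟨fun z => ![z, g z, K z (g z)], ?_, fun z hz => mem_halfPlaneSurface.mpr ⟨?_, ?_⟩,
    ?_, ?_⟩
  · rw [differentiableOn_pi]
    intro k
    fin_cases k
    · exact differentiableOn_id
    · exact hg.1
    · change DifferentiableOn ℂ (fun z => K z (g z)) halfPlane
      have hgd := hg.1
      have e1 : DifferentiableOn ℂ (fun z => (β 0 * g z + β 1 * z : ℂ)⁻¹) halfPlane :=
        DifferentiableOn.inv (by fun_prop) fun z hz => hden hz (hg.2 hz)
      have e2 : DifferentiableOn ℂ (fun z : ℂ => z⁻¹) halfPlane :=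
        differentiableOn_id.inv fun z hz => ne_zero_of_mem_halfPlane hz
      have e3 : DifferentiableOn ℂ (fun z => (g z)⁻¹) halfPlane :=
        hgd.inv fun z hz => ne_zero_of_mem_halfPlane (hg.2 hz)
      have e4 : DifferentiableOn ℂ (fun z => (β 0 * -z⁻¹ + β 1 * -(g z)⁻¹ : ℂ)⁻¹) halfPlane :=
        DifferentiableOn.inv (by fun_prop) fun z hz => hden' hz (hg.2 hz)
      simp only [hK]
      fun_prop
  · intro k
    fin_cases k
    · exact hz
    · exact hg.2 hz
    · exact hKmem hz (hg.2 hz)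
  · have := hKeq hz (hg.2 hz)
    simp only [Matrix.cons_val]
    linear_combination this
  · funext k
    fin_cases k
    · rfl
    · exact hgp
    · change K (p 0) (g (p 0)) = p 2
      rw [hgp, huniq p hp]
  · funext k
    fin_cases k
    · rfl
    · exact hgq
    · change K (q 0) (g (q 0)) = q 2
      rw [hgq, huniq q hq]

theorem hasCoordinateDiscs_of_nonpos {β : Fin 3 → ℝ} {s : ℝ} (hs : 0 < s) (hβs : ∑ j, β j = s)
    (hβ : ∀ i j, i ≠ j → 0 ≤ β i + β j) {k : Fin 3} (hk : β k ≤ 0) :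
    HasCoordinateDiscs halfPlane (halfPlaneSurface β s) := by
  intro p hp q hq
  rcases eq_or_ne p q with rfl | hpq
  · exact exists_const_disc hp
  obtain ⟨σ, hσ, hmax⟩ : ∃ σ : Equiv.Perm (Fin 3), β (σ 2) ≤ 0 ∧
      hypRatio (p (σ 1)) (q (σ 1)) ≤ hypRatio (p (σ 0)) (q (σ 0)) := by
    set τ : Equiv.Perm (Fin 3) := Equiv.swap 2 k
    have hτ : τ 2 = k := Equiv.swap_apply_left 2 k
    rcases le_total (hypRatio (p (τ 1)) (q (τ 1))) (hypRatio (p (τ 0)) (q (τ 0))) with h | h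
    · exact ⟨τ, by rwa [hτ], h⟩
    · refine ⟨τ * Equiv.swap 0 1, ?_, ?_⟩
      · have : (Equiv.swap 0 1 : Equiv.Perm (Fin 3)) 2 = 2 := by decide
        rwa [Equiv.Perm.mul_apply, this, hτ]
      · simpa [Equiv.Perm.mul_apply] using h
  have hsum : β (σ 0) + β (σ 1) + β (σ 2) = s := by
    rw [← hβs, ← Equiv.sum_comp σ β, Fin.sum_univ_three]
  have h02 := hβ (σ 0) (σ 2) (σ.injective.ne (by decide))
  have h12 := hβ (σ 1) (σ 2) (σ.injective.ne (by decide))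
  have hinv : ∀ x y : Fin 3 → ℂ, x ∘ σ = y ∘ σ → x = y := fun x y h =>
    σ.surjective.injective_comp_right h
  have hσσ : ∀ x : Fin 3 → ℂ, (x ∘ σ) ∘ σ.symm = x := fun x => by
    funext k
    simp
  obtain ⟨h, hd, hm, hhp, hhq⟩ := exists_disc_halfPlaneSurface (β := β ∘ σ) hs
    (by simp only [Function.comp_apply]; linarith) (by simp only [Function.comp_apply]; linarith)
    (by simp only [Function.comp_apply]; linarith) hσ (halfPlaneSurface_comp_perm hp σ)
    (halfPlaneSurface_comp_perm hq σ) (fun h => hpq (hinv _ _ h)) hmax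
  simp only [Function.comp_apply] at hhp hhq
  refine ⟨σ 0, fun z => h z ∘ σ.symm, comp_perm_disc hd σ.symm, fun z hz => ?_, ?_, ?_⟩
  · have := halfPlaneSurface_comp_perm (hm hz) σ.symm
    have e : (β ∘ σ) ∘ σ.symm = β := by
      funext k
      simp
    rwa [e] at this
  · simp only [hhp, hσσ]
  · simp only [hhq, hσσ]

/-- If all `β j` are positive, then the real Möbius transformations
`x ↦ (c β j + x) / (c β j - x)`, where `c² β₀ β₁ β₂ = s`, map the surface to
`ξ₀ ξ₁ ξ₂ = -1`. -/
theorem hasCoordinateDiscs_of_pos {β : Fin 3 → ℝ} {s : ℝ} (hs : 0 < s) (hβ : ∀ j, 0 < β j) :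
    HasCoordinateDiscs halfPlane (halfPlaneSurface β s) := by
  have hβp : 0 < β 0 * β 1 * β 2 := mul_pos (mul_pos (hβ 0) (hβ 1)) (hβ 2)
  set c : ℝ := √(s / (β 0 * β 1 * β 2)) with hc
  have hc0 : 0 < c := Real.sqrt_pos.mpr (div_pos hs hβp)
  have hcs : c ^ 2 * (β 0 * β 1 * β 2) = s := by
    rw [hc, Real.sq_sqrt (div_pos hs hβp).le, div_mul_cancel₀ _ hβp.ne']
  have hcsC : (c : ℂ) ^ 2 * (β 0 * β 1 * β 2) = s := by exact_mod_cast hcs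
  have hcC : (c : ℂ) ≠ 0 := by exact_mod_cast hc0.ne'
  set b : Fin 3 → ℝ := fun j => c * β j with hb
  have hb0 : ∀ j, 0 < b j := fun j => mul_pos hc0 (hβ j)
  have hbC : ∀ j, (b j : ℂ) ≠ 0 := fun j => by exact_mod_cast (hb0 j).ne'
  have hsub : ∀ j, ∀ z ∈ halfPlane, (b j : ℂ) - z ≠ 0 :=
    fun j z hz => ne_ofReal_of_mem_halfPlane hz (b j)
  have hadd : ∀ z ∈ halfPlane, z + 1 ≠ 0 := fun z hz h => by
    apply ne_ofReal_of_mem_halfPlane hz (-1)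
    push_cast
    linear_combination -h
  have hφ : ∀ j, ∀ z ∈ halfPlane, ((b j : ℂ) + z) / (b j - z) = (-1 : ℝ) + (2 * b j : ℝ) /
      ((b j : ℝ) - z) := fun j z hz => by
    have := hsub j z hz
    push_cast
    field_simp
    ring
  have hψ : ∀ j, ∀ z ∈ halfPlane, (b j : ℂ) * (z - 1) / (z + 1) = (b j : ℝ) + (2 * b j : ℝ) /
      ((-1 : ℝ) - z) := fun j z hz => by
    have := hadd z hz
    have h2 : (((-1 : ℝ) : ℂ) - z) = -(z + 1) := by push_cast; ring
    rw [h2, div_neg]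
    push_cast
    field_simp
    ring
  have hφm : ∀ j, MapsTo (fun z : ℂ => ((b j : ℂ) + z) / (b j - z)) halfPlane halfPlane := by
    intro j z hz
    simp only [hφ j z hz]
    exact (isNevanlinna_add_div_sub (-1) (b j) (by linarith [hb0 j] : 0 < 2 * b j)).2 hz
  have hψm : ∀ j, MapsTo (fun z : ℂ => (b j : ℂ) * (z - 1) / (z + 1)) halfPlane halfPlane := by
    intro j z hz
    simp only [hψ j z hz]
    exact (isNevanlinna_add_div_sub (b j) (-1) (by linarith [hb0 j] : 0 < 2 * b j)).2 hz
  refine hasCoordinateDiscs_productSurface.transport (fun j z => ((b j : ℂ) + z) / (b j - z))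
    (fun j z => (b j : ℂ) * (z - 1) / (z + 1)) (fun j => ?_) (fun j => ?_) hφm ?_
    (fun x hx => hx.1) (fun x hx => hx.1) (fun x hx => ⟨fun j => hφm j (hx.1 j), ?_⟩)
    (fun x hx => mem_halfPlaneSurface.mpr ⟨fun j => hψm j (hx.1 j), ?_⟩)
  · exact DifferentiableOn.div (by fun_prop) (by fun_prop) (hsub j)
  · exact DifferentiableOn.div (by fun_prop) (by fun_prop) hadd
  · intro j z hz
    have h1 := hsub j z hz
    have h2 := hbC j
    have e1 : ((b j : ℂ) + z) / (b j - z) - 1 = 2 * z / (b j - z) := by field_simp; ring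
    have e2 : ((b j : ℂ) + z) / (b j - z) + 1 = 2 * b j / (b j - z) := by field_simp; ring
    rw [e1, e2]
    field_simp
  · have hx2 := (mem_halfPlaneSurface.mp hx).2
    have h0 := hsub 0 _ (hx.1 0)
    have h1 := hsub 1 _ (hx.1 1)
    have h2 := hsub 2 _ (hx.1 2)
    rw [Fin.prod_univ_three]
    rw [div_mul_div_comm, div_mul_div_comm, div_eq_iff (by positivity)]
    simp only [hb]
    push_cast
    linear_combination 2 * (c : ℂ) * hx2 + 2 * (c : ℂ) * hcsC
  · have hx2 := hx.2
    rw [Fin.prod_univ_three] at hx2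
    have h0 := hadd _ (hx.1 0)
    have h1 := hadd _ (hx.1 1)
    have h2 := hadd _ (hx.1 2)
    rw [← hcsC]
    simp only [hb]
    push_cast
    field_simp
    linear_combination 4 * ((β 0 : ℂ) * β 1 * β 2) * hx2

/-! ### The Cayley transform of the surface -/

theorem exists_unimodular (x : ℂ) : ∃ ε : ℂ, conj ε * ε = 1 ∧ x = ‖x‖ * ε := by
  refine ⟨Complex.exp (x.arg * Complex.I), ?_, (Complex.norm_mul_exp_arg_mul_I x).symm⟩
  rw [mul_comm, Complex.mul_conj, Complex.normSq_eq_norm_sq, Complex.norm_exp_ofReal_mul_I]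
  simp

/-- A rotation of the coordinates replaces the coefficients `α j` by `‖α j‖`. -/
theorem exists_rotation (α : Fin 3 → ℂ) : ∃ u : Fin 3 → ℂ, (∀ j, conj (u j) * u j = 1) ∧
    ∀ z : Fin 3 → ℂ, α 0 * z 0 + α 1 * z 1 + α 2 * z 2 =
      conj (α 2) * z 0 * z 1 + conj (α 1) * z 0 * z 2 + conj (α 0) * z 1 * z 2 ↔
      ‖α 0‖ * (u 0 * z 0) + ‖α 1‖ * (u 1 * z 1) + ‖α 2‖ * (u 2 * z 2) =
        ‖α 2‖ * (u 0 * z 0) * (u 1 * z 1) + ‖α 1‖ * (u 0 * z 0) * (u 2 * z 2) +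
        ‖α 0‖ * (u 1 * z 1) * (u 2 * z 2) := by
  choose ε hε hα using fun j => exists_unimodular (α j)
  -- Multiplying the equation by `U` makes the coefficients of both sides nonnegative in the
  -- coordinates `ε j * U * z j`.
  set U : ℂ := conj (ε 0) * conj (ε 1) * conj (ε 2) with hU
  have hUU : conj U * U = 1 := by
    simp only [hU, map_mul, Complex.conj_conj]
    linear_combination hε 0 * (conj (ε 1) * ε 1 * (conj (ε 2) * ε 2)) +
      hε 1 * (conj (ε 2) * ε 2) + hε 2
  have hU0 : U ≠ 0 := right_ne_zero_of_mul_eq_one hUU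
  have hc : ∀ j, conj (α j) = ‖α j‖ * conj (ε j) := fun j => by
    conv_lhs => rw [hα j]
    rw [map_mul, Complex.conj_ofReal]
  have e01 : ε 0 * ε 1 * U = conj (ε 2) := by
    rw [hU]
    linear_combination conj (ε 2) * (hε 0 * (conj (ε 1) * ε 1) + hε 1)
  have e02 : ε 0 * ε 2 * U = conj (ε 1) := by
    rw [hU]
    linear_combination conj (ε 1) * (hε 0 * (conj (ε 2) * ε 2) + hε 2)
  have e12 : ε 1 * ε 2 * U = conj (ε 0) := by
    rw [hU]
    linear_combination conj (ε 0) * (hε 1 * (conj (ε 2) * ε 2) + hε 2)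
  refine ⟨fun j => ε j * U, fun j => ?_, fun z => ?_⟩
  · rw [map_mul]
    linear_combination hε j * (conj U * U) + hUU
  · rw [hc 0, hc 1, hc 2, ← e01, ← e02, ← e12]
    have h0 := hα 0
    have h1 := hα 1
    have h2 := hα 2
    constructor
    · intro h
      linear_combination U * h - U * z 0 * h0 - U * z 1 * h1 - U * z 2 * h2
    · intro h
      refine mul_left_cancel₀ hU0 ?_
      linear_combination h + U * z 0 * h0 + U * z 1 * h1 + U * z 2 * h2

theorem one_sub_ne_zero_of_norm_lt {z : ℂ} (hz : ‖z‖ < 1) : 1 - z ≠ 0 := by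
  intro h
  rw [← sub_eq_zero.mp h] at hz
  simp at hz

theorem add_I_ne_zero {z : ℂ} (hz : z ∈ halfPlane) : z + Complex.I ≠ 0 := by
  intro h
  have h1 : 0 < z.im := hz
  have := congrArg Complex.im h
  simp at this
  linarith

theorem cayley_mem_halfPlane {z : ℂ} (hz : ‖z‖ < 1) :
    Complex.I * (1 + z) / (1 - z) ∈ halfPlane := by
  have h1 := Complex.normSq_pos.mpr (one_sub_ne_zero_of_norm_lt hz)
  have h2 : Complex.normSq z < 1 := by
    rw [Complex.normSq_eq_norm_sq]
    nlinarith [norm_nonneg z]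
  have h3 : (Complex.I * (1 + z) / (1 - z)).im =
      (1 - Complex.normSq z) / Complex.normSq (1 - z) := by
    rw [Complex.div_im]
    simp [Complex.normSq_apply]
    ring
  change 0 < Complex.im _
  rw [h3]
  exact div_pos (by linarith) h1

theorem norm_cayley_inv_lt {z : ℂ} (hz : z ∈ halfPlane) :
    ‖(z - Complex.I) / (z + Complex.I)‖ < 1 := by
  have h0 := add_I_ne_zero hz
  have h1 : 0 < z.im := hz
  rw [← sq_lt_one_iff₀ (norm_nonneg _), ← Complex.normSq_eq_norm_sq, Complex.normSq_div,
    div_lt_one (Complex.normSq_pos.mpr h0)]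
  simp [Complex.normSq_apply]
  nlinarith

theorem norm_eq_one_of_conj_mul {u : ℂ} (hu : conj u * u = 1) : ‖u‖ = 1 := by
  have h := congrArg norm hu
  rw [norm_mul, Complex.norm_conj, norm_one] at h
  nlinarith [norm_nonneg u]

/-- After a rotation and the Cayley transform, `M_α` becomes a surface in the product of
half-planes, with `β j = ∑ k, ‖α k‖ - 2 * ‖α j‖`; the triangle inequality is `β > 0`. -/
theorem hasCoordinateDiscs_surfaceM {α : Fin 3 → ℂ} (hα : α ≠ 0) :
    HasCoordinateDiscs (ball 0 1) (surfaceM α) := by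
  obtain ⟨u, hu, hrot⟩ := exists_rotation α
  set s : ℝ := ∑ k, ‖α k‖ with hs
  set β : Fin 3 → ℝ := fun j => s - 2 * ‖α j‖ with hβ
  have hs3 : s = ‖α 0‖ + ‖α 1‖ + ‖α 2‖ := by rw [hs, Fin.sum_univ_three]
  have hs0 : 0 < s := by
    obtain ⟨k, hk⟩ := Function.ne_iff.mp hα
    exact Finset.sum_pos' (fun _ _ => norm_nonneg _) ⟨k, Finset.mem_univ k, norm_pos_iff.mpr hk⟩
  have hβs : ∑ j, β j = s := by
    rw [Fin.sum_univ_three]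
    simp only [hβ]
    linarith
  have hβ2 : ∀ i j, i ≠ j → 0 ≤ β i + β j := by
    intro i j hij
    have h0 := norm_nonneg (α 0)
    have h1 := norm_nonneg (α 1)
    have h2 := norm_nonneg (α 2)
    simp only [hβ]
    fin_cases i <;> fin_cases j <;> simp at hij ⊢ <;> linarith
  have hN : HasCoordinateDiscs halfPlane (halfPlaneSurface β s) := by
    by_cases h : ∀ j, 0 < β j
    · exact hasCoordinateDiscs_of_pos hs0 h
    · push Not at h
      obtain ⟨k, hk⟩ := h
      exact hasCoordinateDiscs_of_nonpos hs0 hβs hβ2 hk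
  have hnu : ∀ j, ‖u j‖ = 1 := fun j => norm_eq_one_of_conj_mul (hu j)
  have hlt : ∀ j z, ‖z‖ < 1 → ‖u j * z‖ < 1 := fun j z hz => by
    rwa [norm_mul, hnu, one_mul]
  have hsC : (s : ℂ) = ‖α 0‖ + ‖α 1‖ + ‖α 2‖ := by exact_mod_cast hs3
  -- The Cayley transform turns one equation into the other, up to the factor `4`.
  have hequiv : ∀ y : Fin 3 → ℂ, (∀ j, 1 - y j ≠ 0) →
      (‖α 0‖ * y 0 + ‖α 1‖ * y 1 + ‖α 2‖ * y 2 =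
        ‖α 2‖ * y 0 * y 1 + ‖α 1‖ * y 0 * y 2 + ‖α 0‖ * y 1 * y 2 ↔
      β 0 * (Complex.I * (1 + y 1) / (1 - y 1)) * (Complex.I * (1 + y 2) / (1 - y 2)) +
        β 1 * (Complex.I * (1 + y 0) / (1 - y 0)) * (Complex.I * (1 + y 2) / (1 - y 2)) +
        β 2 * (Complex.I * (1 + y 0) / (1 - y 0)) * (Complex.I * (1 + y 1) / (1 - y 1)) =
        -(s : ℂ)) := by
    intro y hy
    have h0 := hy 0
    have h1 := hy 1
    have h2 := hy 2
    have hI2 := Complex.I_sq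
    have hform : β 0 * (Complex.I * (1 + y 1) / (1 - y 1)) * (Complex.I * (1 + y 2) / (1 - y 2)) +
        β 1 * (Complex.I * (1 + y 0) / (1 - y 0)) * (Complex.I * (1 + y 2) / (1 - y 2)) +
        β 2 * (Complex.I * (1 + y 0) / (1 - y 0)) * (Complex.I * (1 + y 1) / (1 - y 1)) + s =
        (-4) * (‖α 0‖ * y 0 + ‖α 1‖ * y 1 + ‖α 2‖ * y 2 -
        (‖α 2‖ * y 0 * y 1 + ‖α 1‖ * y 0 * y 2 + ‖α 0‖ * y 1 * y 2)) /
        ((1 - y 0) * (1 - y 1) * (1 - y 2)) := by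
      simp only [hβ]
      push_cast
      rw [hsC]
      field_simp
      rw [hI2]
      ring
    rw [eq_neg_iff_add_eq_zero, hform, ← sub_eq_zero]
    simp [h0, h1, h2]
  have hback : ∀ y : ℂ, 1 - y ≠ 0 →
      (Complex.I * (1 + y) / (1 - y) - Complex.I) / (Complex.I * (1 + y) / (1 - y) + Complex.I) =
        y := by
    intro y hy
    have e1 : Complex.I * (1 + y) / (1 - y) - Complex.I = 2 * Complex.I * y / (1 - y) := by
      field_simp; ring
    have e2 : Complex.I * (1 + y) / (1 - y) + Complex.I = 2 * Complex.I / (1 - y) := by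
      field_simp; ring
    rw [e1, e2]
    field_simp
  refine hN.transport (fun j z => Complex.I * (1 + u j * z) / (1 - u j * z))
    (fun j x => conj (u j) * ((x - Complex.I) / (x + Complex.I))) (fun j => ?_) (fun j => ?_)
    (fun j z hz => cayley_mem_halfPlane (hlt j z (by simpa using hz))) ?_ (fun x hx => hx.1)
    (fun x hx j => by simpa using hx.1 j) (fun x hx => mem_halfPlaneSurface.mpr
      ⟨fun j => cayley_mem_halfPlane (hlt j _ (hx.1 j)), ?_⟩) (fun x hx => ?_)
  · exact DifferentiableOn.div (by fun_prop) (by fun_prop)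
      fun z hz => one_sub_ne_zero_of_norm_lt (hlt j z (by simpa using hz))
  · exact (DifferentiableOn.div (by fun_prop) (by fun_prop) fun z hz => add_I_ne_zero hz).const_mul
      _
  · intro j z hz
    simp only [hback _ (one_sub_ne_zero_of_norm_lt (hlt j z (by simpa using hz)))]
    rw [← mul_assoc, hu, one_mul]
  · exact (hequiv (fun j => u j * x j)
      fun j => one_sub_ne_zero_of_norm_lt (hlt j _ (hx.1 j))).mp ((hrot x).mp hx.2)
  · refine ⟨fun j => ?_,
      (hrot fun j => conj (u j) * ((x j - Complex.I) / (x j + Complex.I))).mpr ?_⟩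
    · change ‖conj (u j) * ((x j - Complex.I) / (x j + Complex.I))‖ < 1
      rw [norm_mul, Complex.norm_conj, hnu, one_mul]
      exact norm_cayley_inv_lt (hx.1 j)
    · have hcancel : ∀ j, u j * (conj (u j) * ((x j - Complex.I) / (x j + Complex.I))) =
          (x j - Complex.I) / (x j + Complex.I) := fun j => by
        linear_combination ((x j - Complex.I) / (x j + Complex.I)) * hu j
      have hne : ∀ j, 1 - (x j - Complex.I) / (x j + Complex.I) ≠ 0 :=
        fun j => one_sub_ne_zero_of_norm_lt (norm_cayley_inv_lt (hx.1 j))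
      have hfwd : ∀ j, Complex.I * (1 + (x j - Complex.I) / (x j + Complex.I)) /
          (1 - (x j - Complex.I) / (x j + Complex.I)) = x j := fun j => by
        have h := add_I_ne_zero (hx.1 j)
        have e1 : 1 + (x j - Complex.I) / (x j + Complex.I) = 2 * x j / (x j + Complex.I) := by
          field_simp; ring
        have e2 : 1 - (x j - Complex.I) / (x j + Complex.I) =
            2 * Complex.I / (x j + Complex.I) := by
          field_simp; ring
        rw [e1, e2]
        field_simp
      simp only [hcancel]
      refine (hequiv (fun j => (x j - Complex.I) / (x j + Complex.I)) hne).mpr ?_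
      simp only [hfwd]
      exact (mem_halfPlaneSurface.mp hx).2

/-! ### Invariant distances -/

theorem one_sub_conj_mul_ne_zero {a z : ℂ} (ha : ‖a‖ < 1) (hz : ‖z‖ < 1) :
    1 - conj a * z ≠ 0 := by
  refine one_sub_ne_zero_of_norm_lt ?_
  rw [norm_mul, Complex.norm_conj]
  exact mul_lt_one_of_nonneg_of_lt_one_left (norm_nonneg _) ha hz.le

theorem norm_moebius_lt {a z : ℂ} (ha : ‖a‖ < 1) (hz : ‖z‖ < 1) :
    ‖(z - a) / (1 - conj a * z)‖ < 1 := by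
  have h0 := one_sub_conj_mul_ne_zero ha hz
  have h1 : Complex.normSq a < 1 := by
    rw [Complex.normSq_eq_norm_sq]; nlinarith [norm_nonneg a]
  have h2 : Complex.normSq z < 1 := by
    rw [Complex.normSq_eq_norm_sq]; nlinarith [norm_nonneg z]
  rw [← sq_lt_one_iff₀ (norm_nonneg _), ← Complex.normSq_eq_norm_sq, Complex.normSq_div,
    div_lt_one (Complex.normSq_pos.mpr h0), ← sub_pos]
  have : Complex.normSq (1 - conj a * z) - Complex.normSq (z - a) =
      (1 - Complex.normSq a) * (1 - Complex.normSq z) := by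
    simp [Complex.normSq_apply]; ring
  rw [this]
  exact mul_pos (by linarith) (by linarith)

theorem differentiableOn_moebius {a : ℂ} (ha : ‖a‖ < 1) :
    DifferentiableOn ℂ (fun z => (z - a) / (1 - conj a * z)) (ball 0 1) :=
  DifferentiableOn.div (by fun_prop) (by fun_prop)
    fun _ hz => one_sub_conj_mul_ne_zero ha (by simpa using hz)

theorem norm_moebius_comm (z w : ℂ) :
    ‖(z - w) / (1 - conj w * z)‖ = ‖(w - z) / (1 - conj z * w)‖ := by
  have : 1 - conj w * z = conj (1 - conj z * w) := by simp [mul_comm]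
  rw [norm_div, norm_div, this, Complex.norm_conj, norm_sub_rev]

theorem poincareDist_zero_left (t : ℂ) : poincareDist 0 t = Real.artanh ‖t‖ := by
  simp [poincareDist]

/-- The Schwarz–Pick lemma at the origin, in terms of the Poincaré distance. -/
theorem poincareDist_le_of_mapsTo {G : ℂ → ℂ} (hd : DifferentiableOn ℂ G (ball 0 1))
    (hm : MapsTo G (ball 0 1) (ball 0 1)) {t : ℂ} (ht : t ∈ ball (0 : ℂ) 1) :
    poincareDist (G 0) (G t) ≤ poincareDist 0 t := by
  have ht' : ‖t‖ < 1 := by simpa using ht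
  have h0 : ‖G 0‖ < 1 := by simpa using hm (mem_ball_self one_pos)
  have hmap : MapsTo (fun z => (G z - G 0) / (1 - conj (G 0) * G z)) (ball 0 1)
      (closedBall 0 1) := by
    intro z hz
    have h1 : ‖G z‖ < 1 := by simpa using hm hz
    simpa using (norm_moebius_lt h0 h1).le
  have h := Complex.norm_le_norm_of_mapsTo_ball ((differentiableOn_moebius h0).comp hd hm) hmap
    (by simp) ht'
  rw [poincareDist_zero_left, poincareDist]
  refine Real.artanh_le_artanh (by linarith [norm_nonneg ((G 0 - G t) / (1 - conj (G t) * G 0))])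
    ht' ?_
  rw [norm_moebius_comm]
  exact h

theorem HolomorphicOnSet.comp_disc {E : Type*} [NormedAddCommGroup E] [NormedSpace ℂ E]
    {V : Set E} {F : E → ℂ} (hF : HolomorphicOnSet V F) {f : ℂ → E} {s : Set ℂ} (hs : IsOpen s)
    (hd : DifferentiableOn ℂ f s) (hm : MapsTo f s V) : DifferentiableOn ℂ (F ∘ f) s := by
  intro z hz
  obtain ⟨W, hW, hzW, g, hg, he⟩ := hF (f z) (hm hz)
  have hfz := hd.differentiableAt (hs.mem_nhds hz)
  have hgz := hg.differentiableAt (hW.mem_nhds hzW)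
  refine (DifferentiableAt.congr_of_eventuallyEq (hgz.comp z hfz) ?_).differentiableWithinAt
  filter_upwards [hs.mem_nhds hz, hfz.continuousAt (hW.mem_nhds hzW)] with y hy hyW
  exact he ⟨hm hy, hyW⟩

theorem caratheodoryDist_le_lempertFunction {E : Type*} [NormedAddCommGroup E]
    [NormedSpace ℂ E] (V : Set E) (z w : E) : caratheodoryDist V z w ≤ lempertFunction V z w := by
  refine iSup₂_le fun F hF => le_iInf₂ fun t ht => ?_
  obtain ⟨ht, f, hd, hm, h0, h1⟩ := ht
  refine ENNReal.ofReal_le_ofReal ?_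
  have := poincareDist_le_of_mapsTo (hF.1.comp_disc isOpen_ball hd hm) (hF.2.comp hm) ht
  simpa only [Function.comp_apply, h0, h1] using this

theorem caratheodoryDist_anti {E : Type*} [NormedAddCommGroup E] [NormedSpace ℂ E] {V D : Set E}
    (h : V ⊆ D) (z w : E) : caratheodoryDist D z w ≤ caratheodoryDist V z w := by
  refine iSup₂_le fun F hF => le_iSup₂_of_le F ⟨fun x hx => ?_, hF.2.mono_left h⟩ le_rfl
  obtain ⟨W, hW, hxW, g, hg, he⟩ := hF.1 x (h hx)
  exact ⟨W, hW, hxW, g, hg, he.mono (inter_subset_inter_left _ h)⟩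

theorem poincareDist_coord_le (j : Fin 3) (z w : Fin 3 → ℂ) :
    ENNReal.ofReal (poincareDist (z j) (w j)) ≤ caratheodoryDist tridisc z w := by
  refine le_iSup₂_of_le (fun x : Fin 3 → ℂ => x j) ⟨fun x _ => ?_, fun x hx => ?_⟩ le_rfl
  · exact ⟨univ, isOpen_univ, mem_univ x, fun x => x j, by fun_prop, fun _ _ => rfl⟩
  · simpa using hx j

/-- A coordinate disc is a complex geodesic of the tridisc, hence realizes the Carathéodory
distance of the tridisc. -/
theorem HasCoordinateDiscs.lempertFunction_le {N : Set (Fin 3 → ℂ)} (hN : N ⊆ tridisc)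
    (h : HasCoordinateDiscs (ball 0 1) N) {z w : Fin 3 → ℂ} (hz : z ∈ N) (hw : w ∈ N) :
    lempertFunction N z w ≤ caratheodoryDist tridisc z w := by
  obtain ⟨j, f, hd, hm, hfz, hfw⟩ := h z hz w hw
  refine le_trans ?_ (poincareDist_coord_le j z w)
  have hzj : ‖z j‖ < 1 := hN hz j
  have hwj : ‖w j‖ < 1 := hN hw j
  have hzj' : ‖-z j‖ < 1 := by rwa [norm_neg]
  have ht := norm_moebius_lt hzj hwj
  have hden := one_sub_conj_mul_ne_zero hzj hwj
  have hden' := one_sub_conj_mul_ne_zero hzj hzj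
  have hmap : MapsTo (fun x => (x - -z j) / (1 - conj (-z j) * x)) (ball 0 1) (ball 0 1) :=
    fun x hx => by simpa using norm_moebius_lt hzj' (by simpa using hx : ‖x‖ < 1)
  refine iInf₂_le_of_le ((w j - z j) / (1 - conj (z j) * w j))
    ⟨by simpa using ht, _, hd.comp (differentiableOn_moebius hzj') hmap, hm.comp hmap, ?_, ?_⟩ ?_
  · simp [hfz]
  · have : ((w j - z j) / (1 - conj (z j) * w j) - -z j) /
        (1 - conj (-z j) * ((w j - z j) / (1 - conj (z j) * w j))) = w j := by
      have e1 : (w j - z j) / (1 - conj (z j) * w j) - -z j =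
          w j * (1 - conj (z j) * z j) / (1 - conj (z j) * w j) := by
        rw [eq_div_iff hden, sub_mul, div_mul_cancel₀ _ hden]
        ring
      have e2 : 1 - conj (-z j) * ((w j - z j) / (1 - conj (z j) * w j)) =
          (1 - conj (z j) * z j) / (1 - conj (z j) * w j) := by
        rw [map_neg, eq_div_iff hden]
        linear_combination conj (z j) * div_mul_cancel₀ (w j - z j) hden
      rw [e1, e2, div_div_div_cancel_right₀ hden, mul_div_assoc, div_self hden', mul_one]
    simp only [Function.comp_apply, this, hfw]
  · rw [poincareDist_zero_left, poincareDist, norm_moebius_comm]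

theorem tridisc_eq_ball : tridisc = ball (0 : Fin 3 → ℂ) 1 := by
  ext x
  simp [tridisc, pi_norm_lt_iff]

theorem isAnalyticSubset_surfaceM (α : Fin 3 → ℂ) : IsAnalyticSubset tridisc (surfaceM α) := by
  have hop : IsOpen tridisc := tridisc_eq_ball ▸ isOpen_ball
  refine ⟨fun z hz => hz.1, ⟨{z | α 0 * z 0 + α 1 * z 1 + α 2 * z 2 =
    conj (α 2) * z 0 * z 1 + conj (α 1) * z 0 * z 2 + conj (α 0) * z 1 * z 2},
    isClosed_eq (by fun_prop) (by fun_prop), rfl⟩, fun x hx => ⟨tridisc, hop, subset_rfl, hx.1, 1,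
    fun _ z => α 0 * z 0 + α 1 * z 1 + α 2 * z 2 -
      (conj (α 2) * z 0 * z 1 + conj (α 1) * z 0 * z 2 + conj (α 0) * z 1 * z 2),
    fun _ => by fun_prop, ?_⟩⟩
  ext z
  simp [surfaceM, sub_eq_zero]
  tauto

/-! ### Nonexistence of retractions -/

/-- An off-diagonal entry `y` in the row `(x, y, z)`, with diagonal entry `x`, of a contractive
projection of `ℓ^∞` onto the kernel of `(a, b, c)`: if `‖a‖ < ‖b‖ + ‖c‖`, then `x = 1`, so
that the rest of the row vanishes. -/
theorem offDiag_eq_zero_of_contractive {a b c x y z : ℂ} (hx : ‖x‖ + ‖y‖ + ‖z‖ ≤ 1)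
    (hy : b * x - a * y = b) (hz : c * x - a * z = c) (habc : ‖a‖ < ‖b‖ + ‖c‖) :
    y = 0 := by
  have hx1 : ‖x - 1‖ = 0 := by
    by_contra hne
    have hpos : 0 < ‖x - 1‖ := lt_of_le_of_ne (norm_nonneg _) (Ne.symm hne)
    have e1 : ‖a‖ * ‖y‖ = ‖b‖ * ‖x - 1‖ := by
      rw [← norm_mul, ← norm_mul]
      congr 1
      linear_combination -hy
    have e2 : ‖a‖ * ‖z‖ = ‖c‖ * ‖x - 1‖ := by
      rw [← norm_mul, ← norm_mul]
      congr 1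
      linear_combination -hz
    have e3 : 1 ≤ ‖x‖ + ‖x - 1‖ := by
      have := norm_sub_le x (x - 1)
      simpa using this
    nlinarith [norm_nonneg a]
  have hx' : x = 1 := sub_eq_zero.mp (norm_eq_zero.mp hx1)
  rw [hx', norm_one] at hx
  exact norm_eq_zero.mp (by linarith [norm_nonneg y, norm_nonneg z])

/-- Every vector `X` annihilated by `α` is tangent at the origin to a holomorphic curve in `M_α`. -/
theorem exists_curve_surfaceM {α : Fin 3 → ℂ} (hα : α 2 ≠ 0) {X : Fin 3 → ℂ}
    (hX : α 0 * X 0 + α 1 * X 1 + α 2 * X 2 = 0) :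
    ∃ γ : ℂ → Fin 3 → ℂ, γ 0 = 0 ∧ HasDerivAt γ X 0 ∧ ∀ᶠ t in nhds 0, γ t ∈ surfaceM α := by
  -- The equation of `M_α` at `(t X₀, t X₁, x₂)`, solved for `x₂ = N t / D t`.
  set N : ℂ → ℂ := fun t => t * (α 2 * X 2 + t * (conj (α 2) * X 0 * X 1)) with hN
  set D : ℂ → ℂ := fun t => α 2 - t * (conj (α 1) * X 0 + conj (α 0) * X 1) with hD
  have hD0 : D 0 = α 2 := by simp [hD]
  have hN0 : N 0 = 0 := by simp [hN]
  have hDne : D 0 ≠ 0 := by rwa [hD0]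
  have hNd : HasDerivAt N (α 2 * X 2) 0 := by
    have : HasDerivAt N _ 0 := (hasDerivAt_id (0 : ℂ)).mul
      (((hasDerivAt_id (0 : ℂ)).mul_const (conj (α 2) * X 0 * X 1)).const_add (α 2 * X 2))
    simpa using this
  have hDd : DifferentiableAt ℂ D 0 := by simp only [hD]; fun_prop
  have h2 : HasDerivAt (fun t => N t / D t) (X 2) 0 := by
    refine (hNd.div hDd.hasDerivAt hDne).congr_deriv ?_
    rw [hN0, hD0]
    field_simp
    ring
  have hγ : HasDerivAt (fun t => ![t * X 0, t * X 1, N t / D t]) X 0 := by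
    rw [hasDerivAt_pi]
    intro k
    fin_cases k
    · simpa using (hasDerivAt_id (0 : ℂ)).mul_const (X 0)
    · simpa using (hasDerivAt_id (0 : ℂ)).mul_const (X 1)
    · exact h2
  have hγ0 : (fun t => ![t * X 0, t * X 1, N t / D t]) 0 = 0 := by
    funext k
    fin_cases k <;> simp [hN0]
  refine ⟨_, hγ0, hγ, ?_⟩
  have hop : tridisc ∈ nhds (0 : Fin 3 → ℂ) := by
    rw [tridisc_eq_ball]; exact ball_mem_nhds _ one_pos
  have hc := hγ.continuousAt
  filter_upwards [hc (by rw [hγ0]; exact hop), hDd.continuousAt.eventually_ne hDne] with t ht htD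
  refine ⟨ht, ?_⟩
  have hND : N t / D t * D t = N t := div_mul_cancel₀ _ htD
  simp only [Matrix.cons_val]
  simp only [hN, hD] at hND ⊢
  linear_combination hND + t * hX

/-- The derivative of a retraction at the origin is a projection, contractive for the sup norm,
onto the kernel of `α`; the triangle inequality excludes such projections. -/
theorem not_isHolomorphicRetract_surfaceM {α : Fin 3 → ℂ} (hα : SatisfiesTriangleInequality α) :
    ¬ IsHolomorphicRetract tridisc (surfaceM α) := by
  rintro ⟨r, hd, hm, hr, hid⟩
  have t2 : ‖α 2‖ < ‖α 0‖ + ‖α 1‖ := hα 1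
  have t1 : ‖α 1‖ < ‖α 0‖ + ‖α 2‖ := by
    have := hα (Equiv.swap 1 2)
    rwa [show Equiv.swap (1 : Fin 3) 2 0 = 0 by decide,
      show Equiv.swap (1 : Fin 3) 2 1 = 2 by decide,
      show Equiv.swap (1 : Fin 3) 2 2 = 1 by decide] at this
  have t0 : ‖α 0‖ < ‖α 1‖ + ‖α 2‖ := by
    have := hα (Equiv.swap 0 2)
    rw [show Equiv.swap (0 : Fin 3) 2 0 = 2 by decide,
      show Equiv.swap (0 : Fin 3) 2 1 = 1 by decide,
      show Equiv.swap (0 : Fin 3) 2 2 = 0 by decide] at this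
    linarith
  have hα2 : α 2 ≠ 0 := by
    intro h
    rw [h, norm_zero] at t0 t1
    linarith
  have h0M : (0 : Fin 3 → ℂ) ∈ surfaceM α := ⟨fun j => by simp, by simp⟩
  have hr0 : r 0 = 0 := hid 0 h0M
  have hrM : ∀ x ∈ tridisc, r x ∈ surfaceM α := fun x hx => hr ▸ mem_image_of_mem r hx
  have hop : tridisc ∈ nhds (0 : Fin 3 → ℂ) := by
    rw [tridisc_eq_ball]; exact ball_mem_nhds _ one_pos
  set A := fderiv ℂ r 0 with hA
  have hrA : HasFDerivAt r A 0 := (hd.differentiableAt hop).hasFDerivAt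
  have hA1 : ‖A‖ ≤ 1 := by
    rw [tridisc_eq_ball] at hd hm
    refine Complex.norm_fderiv_le_one_of_mapsTo_ball hd ?_ one_pos
    rw [hr0]
    exact hm.mono_right ball_subset_closedBall
  have hfix : ∀ X : Fin 3 → ℂ, α 0 * X 0 + α 1 * X 1 + α 2 * X 2 = 0 → A X = X := by
    intro X hX
    obtain ⟨γ, hγ0, hγ, hγM⟩ := exists_curve_surfaceM hα2 hX
    have h1 : HasDerivAt (r ∘ γ) (A X) 0 := by
      refine HasFDerivAt.comp_hasDerivAt 0 ?_ hγ
      rwa [hγ0]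
    refine h1.unique (hγ.congr_of_eventuallyEq ?_)
    filter_upwards [hγM] with t ht
    exact hid _ ht
  have hker : ∀ X : Fin 3 → ℂ, α 0 * A X 0 + α 1 * A X 1 + α 2 * A X 2 = 0 := by
    intro X
    have hl : HasDerivAt (fun t : ℂ => t • X) X 0 := by
      simpa using (hasDerivAt_id (0 : ℂ)).smul_const X
    have h1 : HasDerivAt (fun t : ℂ => r (t • X)) (A X) 0 := by
      refine HasFDerivAt.comp_hasDerivAt (f := fun t : ℂ => t • X) 0 ?_ hl
      rwa [zero_smul]
    have hk : ∀ k, HasDerivAt (fun t : ℂ => r (t • X) k) (A X k) 0 := hasDerivAt_pi.mp h1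
    have h2 := (((hk 0).const_mul (α 0)).add ((hk 1).const_mul (α 1))).add
      ((hk 2).const_mul (α 2))
    have h3 := ((((hk 0).const_mul (conj (α 2))).mul (hk 1)).add
      (((hk 0).const_mul (conj (α 1))).mul (hk 2))).add
      (((hk 1).const_mul (conj (α 0))).mul (hk 2))
    have h4 := h2.unique (h3.congr_of_eventuallyEq (by
      have : ∀ᶠ t : ℂ in nhds 0, t • X ∈ tridisc :=
        hl.continuousAt (by rwa [zero_smul])
      filter_upwards [this] with t ht
      exact (hrM _ ht).2))
    simpa [hr0] using h4
  set R : Fin 3 → Fin 3 → ℂ := fun j k => A (Pi.single k 1) j with hR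
  have hAX : ∀ (X : Fin 3 → ℂ) (j), A X j = X 0 * R j 0 + X 1 * R j 1 + X 2 * R j 2 := by
    intro X j
    have : X = X 0 • Pi.single 0 1 + X 1 • Pi.single 1 1 + X 2 • Pi.single 2 1 := by
      funext k
      fin_cases k <;> simp
    conv_lhs => rw [this]
    simp [hR]
  have hrow : ∀ j, ‖R j 0‖ + ‖R j 1‖ + ‖R j 2‖ ≤ 1 := by
    intro j
    -- The `j`-th row attains its `ℓ¹` norm at the vector of conjugate phases of its entries.
    choose ε hε hRε using fun k => exists_unimodular (R j k)
    have h1 : A (fun k => conj (ε k)) j = ((‖R j 0‖ + ‖R j 1‖ + ‖R j 2‖ : ℝ) : ℂ) := by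
      rw [hAX]
      push_cast
      linear_combination conj (ε 0) * hRε 0 + conj (ε 1) * hRε 1 + conj (ε 2) * hRε 2 +
        ‖R j 0‖ * hε 0 + ‖R j 1‖ * hε 1 + ‖R j 2‖ * hε 2
    have h2 : ‖fun k => conj (ε k)‖ ≤ 1 := (pi_norm_le_iff_of_nonneg zero_le_one).mpr fun k => by
      rw [Complex.norm_conj, norm_eq_one_of_conj_mul (hε k)]
    have h3 := (norm_le_pi_norm (A fun k => conj (ε k)) j).trans (A.le_opNorm _)
    rw [h1, Complex.norm_real, Real.norm_of_nonneg (by positivity)] at h3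
    exact h3.trans (mul_le_one₀ hA1 (norm_nonneg _) h2)
  have h10 := hfix ![α 1, -α 0, 0] (by simp; ring)
  have h20 := hfix ![α 2, 0, -α 0] (by simp; ring)
  have h21 := hfix ![0, α 2, -α 1] (by simp; ring)
  have r1 : R 1 0 = 0 := by
    have e1 := congrFun h10 1
    have e2 := congrFun h21 1
    rw [hAX] at e1 e2
    simp at e1 e2
    exact offDiag_eq_zero_of_contractive (a := α 1) (b := α 0) (c := α 2) (x := R 1 1) (z := R 1 2)
      (by linarith [hrow 1]) (by linear_combination -e1) (by linear_combination e2) t1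
  have r2 : R 2 0 = 0 := by
    have e1 := congrFun h20 2
    have e2 := congrFun h21 2
    rw [hAX] at e1 e2
    simp at e1 e2
    exact offDiag_eq_zero_of_contractive (a := α 2) (b := α 0) (c := α 1) (x := R 2 2) (z := R 2 1)
      (by linarith [hrow 2]) (by linear_combination -e1) (by linear_combination -e2) t2
  have r0 : R 0 1 = 0 := by
    have e1 := congrFun h10 0
    have e2 := congrFun h20 0
    rw [hAX] at e1 e2
    simp at e1 e2
    exact offDiag_eq_zero_of_contractive (a := α 0) (b := α 1) (c := α 2) (x := R 0 0) (z := R 0 2)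
      (by linarith [hrow 0]) (by linear_combination e1) (by linear_combination e2) t0
  have hα1 : α 1 ≠ 0 := by
    intro h
    rw [h, norm_zero] at t0 t2
    linarith
  have r00 : R 0 0 = 1 := by
    have e1 := congrFun h10 0
    rw [hAX] at e1
    simp at e1
    refine mul_left_cancel₀ hα1 ?_
    linear_combination e1 + α 0 * r0
  -- The first column of the derivative is that of the identity, but its range is in `ker α`.
  have hα0 : α 0 = 0 := by
    have e := hker (Pi.single 0 1)
    simp only [show ∀ j, A (Pi.single 0 1) j = R j 0 from fun _ => rfl, r00, r1, r2] at e
    simpa using e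
  rw [hα0, norm_zero] at t1 t2
  linarith

theorem theorem3p1 (α : Fin 3 → ℂ) (hα : α ≠ 0) :
    IsCaratheodorySet tridisc (surfaceM α) ∧
    (∀ z ∈ surfaceM α, ∀ w ∈ surfaceM α,
      lempertFunction (surfaceM α) z w = caratheodoryDist (surfaceM α) z w ∧
      caratheodoryDist (surfaceM α) z w = caratheodoryDist tridisc z w) ∧
    (SatisfiesTriangleInequality α → ¬ IsHolomorphicRetract tridisc (surfaceM α)) := by
  have hsub : surfaceM α ⊆ tridisc := fun z hz => hz.1
  have h1 : ∀ z ∈ surfaceM α, ∀ w ∈ surfaceM α,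
      lempertFunction (surfaceM α) z w ≤ caratheodoryDist tridisc z w := fun z hz w hw =>
    (hasCoordinateDiscs_surfaceM hα).lempertFunction_le hsub hz hw
  have h2 := fun z w => caratheodoryDist_anti hsub z w
  have h3 := fun z w => caratheodoryDist_le_lempertFunction (surfaceM α) z w
  refine ⟨⟨isAnalyticSubset_surfaceM α, fun z hz w hw => ?_⟩, fun z hz w hw => ⟨?_, ?_⟩,
    not_isHolomorphicRetract_surfaceM⟩
  · exact le_antisymm (h2 z w) ((h3 z w).trans (h1 z hz w hw))
  · exact le_antisymm ((h1 z hz w hw).trans (h2 z w)) (h3 z w)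
  · exact le_antisymm ((h3 z w).trans (h1 z hz w hw)) (h2 z w)
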